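/- **Definitions.** For a potential $F(x_1,x_2,x_3,x_4)$ with weights $(w_1,w_2,w_3,w_4)$, $w_4=1$, let $E=\sum_k w_kx_k\partial_{x_k}$, let $C$ be the matrix $C_{ij}=\partial_{x_i}\partial_{x_{5-j}}F$, let $T=EC$ ($E$ applied entrywise), and let $\Delta_F=\det T$. The polynomial $H_4$ potential, with weights $(\frac1{15},\frac25,\frac23,1)$, is $$F_{H_4(0)}=\frac{x_{1}x_{4}^{2}}{2}+x_{2}x_{3}x_{4}+\frac{32x_{1}^{31}}{22395255890625}+\frac{2x_{1}^{19}x_{2}^{2}}{15582375}+\frac{x_{1}^{13}x_{2}^{3}}{72900}+\frac{8x_{1}^{11}x_{3}^{2}}{22275}+\frac{1}{810}x_{1}^{9}x_{2}^{2}x_{3}+\frac{x_{1}^{7}x_{2}^{4}}{1080}+\frac{1}{15}x_{1}^{5}x_{2}x_{3}^{2}+\frac{1}{18}x_{1}^{3}x_{2}^{3}x_{3}+\frac{x_{1}x_{2}^{5}}{240}+\frac{2x_{1}x_{3}^{3}}{3}.$$ The algebraic potential of type $H_4(1)$, with weights $(\frac1{10},\frac12,\frac35,1)$, is $$F_{H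_4(1)}=x_{2}x_{3}x_{4}+\frac{1}{2}x_{1}x_{4}^{2}+\frac{4}{13167}x_{1}(51139x_{1}^{20}-175560x_{1}^{15}x_{2}-95760x_{1}^{10}x_{2}^{2}+1790712x_{1}^{5}x_{2}^{3}-13167x_{2}^{4})-\frac{4}{45}(17x_{1}^{15}+75x_{1}^{10}x_{2}-900x_{1}^{5}x_{2}^{2}+30x_{2}^{3})z^{2}-\frac{1}{18}x_{1}^{4}(17x_{1}^{5}-90x_{2})z^{4}+\frac{1}{6}x_{1}^{3}z^{6}+\frac{1}{105}z^{7},$$ where $z$ is the algebraic function of $(x_1,x_2,x_3)$ defined by $z^2=x_3+4x_1(x_1^5-3x_2)$. Write $\Delta_{H_4(j)}=\det T$ for $F=F_{H_4(j)}$. Consider the families of surfaces $z^2=f_{H_4(j)}(x,y)$ in $\mathbb C^3$ with $$f_{H_4(0)}=x^{5}+t_{15}+5t_{6}^{2}x+5t_{6}x^{3}+y(10t_{1}t_{6}x+5t_{1}x^{3}+t_{10})+5t_{1}^{2}xy^{2}+y^{3},$$ $$f_{H_4(1)}=x(5t_{3}^{2}+5t_{3}x+x^{2})^{2}+y(5t_{1}(t_{3}+x)(5t_{3}^{2}+5t_{3}x+x^{2})+t_{10})+y^{2}(5t_{1}^{2}x+t_{5})+y^{3},$$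 with parameters $(t_1,t_6,t_{10},t_{15})\in\mathbb C^4$ and $(t_1,t_3,t_5,t_{10})\in\mathbb C^4$ respectively. The discriminant locus of a family is the set of parameters for which the surface has a singular point, and its discriminant is a square-free polynomial with zero set the discriminant locus (unique up to a nonzero constant factor). Put $$D_{H_4(0)}=-3125t_{1}^{12}t_{10}^{3}t_{6}^{3}-27t_{1}^{10}t_{10}^{5}-9375t_{1}^{10}t_{10}^{2}t_{6}^{5}-105t_{1}^{8}t_{10}^{4}t_{6}^{2}-9375t_{1}^{8}t_{10}t_{6}^{7}+13695t_{1}^{6}t_{10}^{3}t_{6}^{4}-3125t_{1}^{6}t_{6}^{9}+120t_{1}^{4}t_{10}^{5}t_{6}+36885t_{1}^{4}t_{10}^{2}t_{6}^{6}+2280t_{1}^{2}t_{10}^{4}t_{6}^{3}+35640t_{1}^{2}t_{10}t_{6}^{8}+16t_{10}^{6}-864t_{10}^{3}t_{6}^{5}+11664t_{6}^{10}+3t_{1}t_{15}(3125t_{1}^{12}t_{10}^{2}t_{6}^{2}+6250t_{1}^{10}t_{10}t_{6}^{4}+25t_{1}^{8}t_{10}^{3}t_{6}+3125t_{1}^{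8}t_{6}^{6}-14150t_{1}^{6}t_{10}^{2}t_{6}^{3}-4t_{1}^{4}t_{10}^{4}-24075t_{1}^{4}t_{10}t_{6}^{5}-1980t_{1}^{2}t_{10}^{3}t_{6}^{2}-11700t_{1}^{2}t_{6}^{7}+4320t_{10}^{2}t_{6}^{4})-3t_{15}^{2}(3125t_{1}^{14}t_{10}t_{6}+3125t_{1}^{12}t_{6}^{3}+125t_{1}^{10}t_{10}^{2}-14625t_{1}^{8}t_{10}t_{6}^{2}-11250t_{1}^{6}t_{6}^{4}-2430t_{1}^{4}t_{10}^{2}t_{6}+7830t_{1}^{2}t_{10}t_{6}^{3}-72t_{10}^{3}-1944t_{6}^{5})+25t_{1}^{3}t_{15}^{3}(125t_{1}^{12}-675t_{1}^{6}t_{6}-81t_{1}^{2}t_{10}+729t_{6}^{2})+729t_{15}^{4},$$ $$D_{H_4(1)}=t_{3}^{5}(25t_{1}^{2}t_{3}-4t_{5})^{2}(125t_{1}^{9}t_{3}^{2}-25t_{1}^{7}t_{3}t_{5}-1225t_{1}^{6}t_{3}^{3}+t_{1}^{5}t_{5}^{2}+370t_{1}^{4}t_{3}^{2}t_{5}+3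35t_{1}^{3}t_{3}^{4}-35t_{1}^{2}t_{3}t_{5}^{2}-45t_{1}t_{3}^{3}t_{5}-27t_{3}^{5}+t_{5}^{3})-t_{3}^{3}(10625t_{1}^{12}t_{3}^{3}-4750t_{1}^{10}t_{3}^{2}t_{5}-91750t_{1}^{9}t_{3}^{4}+605t_{1}^{8}t_{3}t_{5}^{2}+54350t_{1}^{7}t_{3}^{3}t_{5}-83175t_{1}^{6}t_{3}^{5}-20t_{1}^{6}t_{5}^{3}-10548t_{1}^{5}t_{3}^{2}t_{5}^{2}+25600t_{1}^{4}t_{3}^{4}t_{5}+22520t_{1}^{3}t_{3}^{6}+805t_{1}^{3}t_{3}t_{5}^{3}-2930t_{1}^{2}t_{3}^{3}t_{5}^{2}-2880t_{1}t_{3}^{5}t_{5}-20t_{1}t_{5}^{4}-1728t_{3}^{7}+136t_{3}^{2}t_{5}^{3})t_{10}+(-1225t_{1}^{11}t_{3}^{3}+255t_{1}^{9}t_{3}^{2}t_{5}+13895t_{1}^{8}t_{3}^{4}-30t_{1}^{7}t_{3}t_{5}^{2}-3900t_{1}^{6}t_{3}^{3}t_{5}-19976t_{1}^{5}t_{3}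^{5}+t_{1}^{5}t_{5}^{3}+550t_{1}^{4}t_{3}^{2}t_{5}^{2}+3700t_{1}^{3}t_{3}^{4}t_{5}+840t_{1}^{2}t_{3}^{6}-40t_{1}^{2}t_{3}t_{5}^{3}-200t_{1}t_{3}^{3}t_{5}^{2}+288t_{3}^{5}t_{5}+t_{5}^{4})t_{10}^{2}+(-27t_{1}^{10}+360t_{1}^{7}t_{3}-36t_{1}^{5}t_{5}-920t_{1}^{4}t_{3}^{2}+160t_{1}^{2}t_{3}t_{5}+480t_{1}t_{3}^{3}-8t_{5}^{2})t_{10}^{3}+16t_{10}^{4}.$$ **Theorem.** (i) The discriminant of the family $z^2=f_{H_4(0)}$ is $D_{H_4(0)}$. The formulas $$x_1=t_{1},\quad x_2=\frac{4}{225}(10t_{1}^{6}-27t_{6}),\quad x_3=\frac{2}{50625}(500t_{1}^{10}-2025t_{1}^{4}t_{6}-486t_{10}),\quad x_4=\frac{8}{11390625}(8125t_{1}^{15}-47250t_{1}^{9}t_{6}-7290t_{1}^{5}t_{10}+54675t_{1}^{3}t_{6}^{2}+13122t_{15})$$ define a bijective change of coordinates $\mathbb C^4\to\mathbb C^4$,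 under which $\Delta_{H_4(0)}$ coincides with $D_{H_4(0)}$ up to a nonzero constant factor. (ii) The discriminant of the family $z^2=f_{H_4(1)}$ is $t_{10}D_{H_4(1)}$. A holomorphic branch of $z$ exists near every point of the double cover $z^2=x_3+4x_1(x_1^5-3x_2)$ with $z\ne0$; for all holomorphic branches, $\Delta_{H_4(1)}$ is one and the same polynomial in $(x_1,x_2,z,x_4)$. The formulas $$x_1=t_{1},\quad x_2=\frac{1}{5}(17t_{1}^{5}-160t_{1}^{2}t_{3}+16t_{5}),\quad z=16t_{3},\quad x_4=\frac{8}{25}(987t_{1}^{10}-15120t_{1}^{7}t_{3}+1512t_{1}^{5}t_{5}+50400t_{1}^{4}t_{3}^{2}-8960t_{1}^{2}t_{3}t_{5}-12800t_{1}t_{3}^{3}-2560t_{10}+448t_{5}^{2})$$ define a bijective change of coordinates $\mathbb C^4\to\mathbb C^4$, $(t_1,t_3,t_5,t_{10})\mapsto(x_1,x_2,z,x_4)$, under which the polynomial $\Delta_{H_4(1)}$ coincides with $D_{H_4(1)}$ up to a nonzero constant factor. (iii) Put $$u_1=t_{1},\quad u_6=\frac{1}{3}(10t_{1}^{3}t_{3}-t_{1}t_{5}-3t_{3}^{2}),\quad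 u_{10}=\frac{1}{3}(-100t_{1}^{4}t_{3}^{2}+20t_{1}^{2}t_{3}t_{5}+15t_{1}t_{3}^{3}+3t_{10}-t_{5}^{2}),\quad u_{15}=\frac{1}{27}(-2000t_{1}^{6}t_{3}^{3}+600t_{1}^{4}t_{3}^{2}t_{5}+450t_{1}^{3}t_{3}^{4}+90t_{1}^{2}t_{10}t_{3}-60t_{1}^{2}t_{3}t_{5}^{2}-45t_{1}t_{3}^{3}t_{5}-9t_{10}t_{5}-54t_{3}^{5}+2t_{5}^{3}).$$ Then, with $x=x'-2t_3$ and $y=y'+\frac13(10t_1^2t_3-t_5)$, the polynomial $f_{H_4(1)}(x,y)$ with parameters $(t_1,t_3,t_5,t_{10})$ equals $f_{H_4(0)}(x',y')$ with parameters $(u_1,u_6,u_{10},u_{15})$, and $$D_{H_4(0)}(u_1,u_6,u_{10},u_{15})=t_{10}^2\,D_{H_4(1)}(t_1,t_3,t_5,t_{10}).$$ -/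

import Mathlib

noncomputable section

namespace H4Family

open MvPolynomial

/-! ## The discriminant `det T` of a potential in four flat coordinates -/

/-- Partial derivative `∂F/∂x_{j+1}` of a function on `ℂ⁴`. -/
def pd (j : Fin 4) (F : (Fin 4 → ℂ) → ℂ) : (Fin 4 → ℂ) → ℂ :=
  fun x => fderiv ℂ F x (Pi.single j 1)

/-- The Euler vector field `E = (1 / w₄) ∑ₖ wₖ xₖ ∂ₖ` applied to `F`. -/
def euler (w : Fin 4 → ℂ) (F : (Fin 4 → ℂ) → ℂ) : (Fin 4 → ℂ) → ℂ :=
  fun x => 1 / w 3 * ∑ k, w k * x k * pd k F x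

/-- The matrix `C`, whose `i`-th row is `∂ᵢ P` for the gradient `P = (∂₄F, ∂₃F, ∂₂F, ∂₁F)`. -/
def hessC (F : (Fin 4 → ℂ) → ℂ) (i j : Fin 4) : (Fin 4 → ℂ) → ℂ :=
  pd i (pd (Fin.rev j) F)

/-- The matrix `T = E C` at the point `x`. -/
def matT (w : Fin 4 → ℂ) (F : (Fin 4 → ℂ) → ℂ) (x : Fin 4 → ℂ) : Matrix (Fin 4) (Fin 4) ℂ :=
  Matrix.of fun i j => euler w (hessC F i j) x

/-- The discriminant `Δ_F = det T` of the potential `F` at the point `x`. -/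
def discr (w : Fin 4 → ℂ) (F : (Fin 4 → ℂ) → ℂ) (x : Fin 4 → ℂ) : ℂ :=
  (matT w F x).det

/-! ## The two potentials; `x = (x₁, x₂, x₃, x₄)` -/

/-- Weights of the flat coordinates of the polynomial potential of type `H₄`. -/
def wH4Zero : Fin 4 → ℂ := ![1 / 15, 2 / 5, 2 / 3, 1]

/-- The polynomial potential of type `H₄`. -/
def potH4Zero (x : Fin 4 → ℂ) : ℂ :=
  x 0 * x 3 ^ 2 / 2 + x 1 * x 2 * x 3 + 32 * x 0 ^ 31 / 22395255890625 +
    2 * x 0 ^ 19 * x 1 ^ 2 / 15582375 + x 0 ^ 13 * x 1 ^ 3 / 72900 + 8 * x 0 ^ 11 * x 2 ^ 2 /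
    22275 + 1 / 810 * x 0 ^ 9 * x 1 ^ 2 * x 2 + x 0 ^ 7 * x 1 ^ 4 / 1080 + 1 /
    15 * x 0 ^ 5 * x 1 * x 2 ^ 2 + 1 / 18 * x 0 ^ 3 * x 1 ^ 3 * x 2 + x 0 * x 1 ^ 5 / 240 +
    2 * x 0 * x 2 ^ 3 / 3

/-- Weights of the flat coordinates of the algebraic potential `H₄(1)`. -/
def wH4One : Fin 4 → ℂ := ![1 / 10, 1 / 2, 3 / 5, 1]

/-- `z` is a holomorphic branch on the open set `U ⊆ ℂ⁴` of the algebraic function defined by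
`-4 x₁ (x₁⁵ - 3 x₂) - x₃ + z² = 0`. -/
def IsBranch (U : Set (Fin 4 → ℂ)) (z : (Fin 4 → ℂ) → ℂ) : Prop :=
  IsOpen U ∧ DifferentiableOn ℂ z U ∧
    ∀ x ∈ U, -4 * x 0 * (x 0 ^ 5 - 3 * x 1) - x 2 + z x ^ 2 = 0

/-- The algebraic potential `H₄(1)`, as a function of `x` for a branch `z`. -/
def potH4One (z : (Fin 4 → ℂ) → ℂ) (x : Fin 4 → ℂ) : ℂ :=
  x 1 * x 2 * x 3 + 1 / 2 * x 0 * x 3 ^ 2 + 4 / 13167 * x 0 * (51139 * x 0 ^ 20 -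
    175560 * x 0 ^ 15 * x 1 - 95760 * x 0 ^ 10 * x 1 ^ 2 + 1790712 * x 0 ^ 5 * x 1 ^ 3 -
    13167 * x 1 ^ 4) - 4 / 45 * (17 * x 0 ^ 15 + 75 * x 0 ^ 10 * x 1 - 900 * x 0 ^ 5 * x 1 ^ 2
    + 30 * x 1 ^ 3) * z x ^ 2 - 1 / 18 * x 0 ^ 4 * (17 * x 0 ^ 5 - 90 * x 1) * z x ^ 4 + 1 /
    6 * x 0 ^ 3 * z x ^ 6 + 1 / 105 * z x ^ 7

/-- The point `x` of `ℂ⁴` that lies below the point `s = (x₁, x₂, z, x₄)` of the double cover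
`z² = x₃ + 4 x₁ (x₁⁵ - 3 x₂)`. -/
def basePoint (s : Fin 4 → ℂ) : Fin 4 → ℂ :=
  ![s 0, s 1, s 2 ^ 2 - 4 * s 0 * (s 0 ^ 5 - 3 * s 1), s 3]

/-! ## Families of surfaces `z² = f(x, y)` and their discriminants -/

/-- The equation `z² - f(x, y)` in the variables `(x, y, z)`. -/
def surface (f : MvPolynomial (Fin 2) ℂ) : MvPolynomial (Fin 3) ℂ :=
  X 2 ^ 2 - rename Fin.castSucc f

/-- The hypersurface `G = 0` of `ℂ³` has a singular point. -/
def IsSingularSurface (G : MvPolynomial (Fin 3) ℂ) : Prop :=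
  ∃ p : Fin 3 → ℂ, eval p G = 0 ∧ ∀ i, eval p (pderiv i G) = 0

/-- The discriminant locus of the family `z² = f t (x, y)`. -/
def discriminantLocus (f : (Fin 4 → ℂ) → MvPolynomial (Fin 2) ℂ) : Set (Fin 4 → ℂ) :=
  {t | IsSingularSurface (surface (f t))}

/-- `δ` is a discriminant of the family `z² = f t (x, y)`: a reduced equation of the
discriminant locus. It is unique up to a nonzero constant factor. -/
def IsDiscriminant (f : (Fin 4 → ℂ) → MvPolynomial (Fin 2) ℂ) (δ : MvPolynomial (Fin 4) ℂ) :
    Prop :=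
  Squarefree δ ∧ discriminantLocus f = {t | eval t δ = 0}

/-! ### The family of type `H₄(0)`; `t = (t₁, t₆, t₁₀, t₁₅)` -/

def exprFH4Zero {R : Type*} [CommRing R] (t1 t6 t10 t15 x y : R) : R :=
  x ^ 5 + t15 + 5 * t6 ^ 2 * x + 5 * t6 * x ^ 3 + y * (10 * t1 * t6 * x + 5 * t1 * x ^ 3 +
    t10) + 5 * t1 ^ 2 * x * y ^ 2 + y ^ 3

def fH4Zero (t : Fin 4 → ℂ) : MvPolynomial (Fin 2) ℂ :=
  exprFH4Zero (C (t 0)) (C (t 1)) (C (t 2)) (C (t 3)) (X 0) (X 1)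

def exprDH4Zero {R : Type*} [CommRing R] (t1 t6 t10 t15 : R) : R :=
  -3125 * t1 ^ 12 * t10 ^ 3 * t6 ^ 3 - 27 * t1 ^ 10 * t10 ^ 5 -
    9375 * t1 ^ 10 * t10 ^ 2 * t6 ^ 5 - 105 * t1 ^ 8 * t10 ^ 4 * t6 ^ 2 -
    9375 * t1 ^ 8 * t10 * t6 ^ 7 + 13695 * t1 ^ 6 * t10 ^ 3 * t6 ^ 4 - 3125 * t1 ^ 6 * t6 ^ 9
    + 120 * t1 ^ 4 * t10 ^ 5 * t6 + 36885 * t1 ^ 4 * t10 ^ 2 * t6 ^ 6 +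
    2280 * t1 ^ 2 * t10 ^ 4 * t6 ^ 3 + 35640 * t1 ^ 2 * t10 * t6 ^ 8 + 16 * t10 ^ 6 -
    864 * t10 ^ 3 * t6 ^ 5 + 11664 * t6 ^ 10 +
    3 * t1 * t15 * (3125 * t1 ^ 12 * t10 ^ 2 * t6 ^ 2 + 6250 * t1 ^ 10 * t10 * t6 ^ 4 +
    25 * t1 ^ 8 * t10 ^ 3 * t6 + 3125 * t1 ^ 8 * t6 ^ 6 - 14150 * t1 ^ 6 * t10 ^ 2 * t6 ^ 3 -
    4 * t1 ^ 4 * t10 ^ 4 - 24075 * t1 ^ 4 * t10 * t6 ^ 5 - 1980 * t1 ^ 2 * t10 ^ 3 * t6 ^ 2 -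
    11700 * t1 ^ 2 * t6 ^ 7 + 4320 * t10 ^ 2 * t6 ^ 4) -
    3 * t15 ^ 2 * (3125 * t1 ^ 14 * t10 * t6 + 3125 * t1 ^ 12 * t6 ^ 3 +
    125 * t1 ^ 10 * t10 ^ 2 - 14625 * t1 ^ 8 * t10 * t6 ^ 2 - 11250 * t1 ^ 6 * t6 ^ 4 -
    2430 * t1 ^ 4 * t10 ^ 2 * t6 + 7830 * t1 ^ 2 * t10 * t6 ^ 3 - 72 * t10 ^ 3 -
    1944 * t6 ^ 5) + 25 * t1 ^ 3 * t15 ^ 3 * (125 * t1 ^ 12 - 675 * t1 ^ 6 * t6 -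
    81 * t1 ^ 2 * t10 + 729 * t6 ^ 2) + 729 * t15 ^ 4

/-- The polynomial `D_{H₄(0)}(t₁, t₆, t₁₀, t₁₅)`. -/
def polyDH4Zero : MvPolynomial (Fin 4) ℂ :=
  exprDH4Zero (X 0) (X 1) (X 2) (X 3)

/-- The coordinate change `(t₁, t₆, t₁₀, t₁₅) ↦ (x₁, x₂, x₃, x₄)`. -/
def coordH4Zero (t : Fin 4 → ℂ) : Fin 4 → ℂ :=
  ![
    t 0,
    4 / 225 * (10 * t 0 ^ 6 - 27 * t 1),
    2 / 50625 * (500 * t 0 ^ 10 - 2025 * t 0 ^ 4 * t 1 - 486 * t 2),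
    8 / 11390625 * (8125 * t 0 ^ 15 - 47250 * t 0 ^ 9 * t 1 - 7290 * t 0 ^ 5 * t 2 +
      54675 * t 0 ^ 3 * t 1 ^ 2 + 13122 * t 3)]

/-! ### The family of type `H₄(1)`; `t = (t₁, t₃, t₅, t₁₀)` -/

def exprFH4One {R : Type*} [CommRing R] (t1 t3 t5 t10 x y : R) : R :=
  x * (5 * t3 ^ 2 + 5 * t3 * x + x ^ 2) ^ 2 + y * (5 * t1 * (t3 + x) * (5 * t3 ^ 2 +
    5 * t3 * x + x ^ 2) + t10) + y ^ 2 * (5 * t1 ^ 2 * x + t5) + y ^ 3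

def fH4One (t : Fin 4 → ℂ) : MvPolynomial (Fin 2) ℂ :=
  exprFH4One (C (t 0)) (C (t 1)) (C (t 2)) (C (t 3)) (X 0) (X 1)

def exprDH4One {R : Type*} [CommRing R] (t1 t3 t5 t10 : R) : R :=
  t3 ^ 5 * (25 * t1 ^ 2 * t3 - 4 * t5) ^ 2 * (125 * t1 ^ 9 * t3 ^ 2 - 25 * t1 ^ 7 * t3 * t5 -
    1225 * t1 ^ 6 * t3 ^ 3 + t1 ^ 5 * t5 ^ 2 + 370 * t1 ^ 4 * t3 ^ 2 * t5 +
    335 * t1 ^ 3 * t3 ^ 4 - 35 * t1 ^ 2 * t3 * t5 ^ 2 - 45 * t1 * t3 ^ 3 * t5 - 27 * t3 ^ 5 +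
    t5 ^ 3) - t3 ^ 3 * (10625 * t1 ^ 12 * t3 ^ 3 - 4750 * t1 ^ 10 * t3 ^ 2 * t5 -
    91750 * t1 ^ 9 * t3 ^ 4 + 605 * t1 ^ 8 * t3 * t5 ^ 2 + 54350 * t1 ^ 7 * t3 ^ 3 * t5 -
    83175 * t1 ^ 6 * t3 ^ 5 - 20 * t1 ^ 6 * t5 ^ 3 - 10548 * t1 ^ 5 * t3 ^ 2 * t5 ^ 2 +
    25600 * t1 ^ 4 * t3 ^ 4 * t5 + 22520 * t1 ^ 3 * t3 ^ 6 + 805 * t1 ^ 3 * t3 * t5 ^ 3 -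
    2930 * t1 ^ 2 * t3 ^ 3 * t5 ^ 2 - 2880 * t1 * t3 ^ 5 * t5 - 20 * t1 * t5 ^ 4 -
    1728 * t3 ^ 7 + 136 * t3 ^ 2 * t5 ^ 3) * t10 + (-1225 * t1 ^ 11 * t3 ^ 3 +
    255 * t1 ^ 9 * t3 ^ 2 * t5 + 13895 * t1 ^ 8 * t3 ^ 4 - 30 * t1 ^ 7 * t3 * t5 ^ 2 -
    3900 * t1 ^ 6 * t3 ^ 3 * t5 - 19976 * t1 ^ 5 * t3 ^ 5 + t1 ^ 5 * t5 ^ 3 +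
    550 * t1 ^ 4 * t3 ^ 2 * t5 ^ 2 + 3700 * t1 ^ 3 * t3 ^ 4 * t5 + 840 * t1 ^ 2 * t3 ^ 6 -
    40 * t1 ^ 2 * t3 * t5 ^ 3 - 200 * t1 * t3 ^ 3 * t5 ^ 2 + 288 * t3 ^ 5 * t5 +
    t5 ^ 4) * t10 ^ 2 + (-27 * t1 ^ 10 + 360 * t1 ^ 7 * t3 - 36 * t1 ^ 5 * t5 -
    920 * t1 ^ 4 * t3 ^ 2 + 160 * t1 ^ 2 * t3 * t5 + 480 * t1 * t3 ^ 3 - 8 * t5 ^ 2) * t10 ^ 3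
    + 16 * t10 ^ 4

/-- The polynomial `D_{H₄(1)}(t₁, t₃, t₅, t₁₀)`. -/
def polyDH4One : MvPolynomial (Fin 4) ℂ :=
  exprDH4One (X 0) (X 1) (X 2) (X 3)

/-- The coordinate change `(t₁, t₃, t₅, t₁₀) ↦ (x₁, x₂, z, x₄)` to the double cover. -/
def coordH4One (t : Fin 4 → ℂ) : Fin 4 → ℂ :=
  ![
    t 0,
    1 / 5 * (17 * t 0 ^ 5 - 160 * t 0 ^ 2 * t 1 + 16 * t 2),
    16 * t 1,
    8 / 25 * (987 * t 0 ^ 10 - 15120 * t 0 ^ 7 * t 1 + 1512 * t 0 ^ 5 * t 2 +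
      50400 * t 0 ^ 4 * t 1 ^ 2 - 8960 * t 0 ^ 2 * t 1 * t 2 - 12800 * t 0 * t 1 ^ 3 -
      2560 * t 3 + 448 * t 2 ^ 2)]

/-- The substitution `(t₁, t₃, t₅, t₁₀) ↦ (u₁, u₆, u₁₀, u₁₅)` relating the two families. -/
def substU (t : Fin 4 → ℂ) : Fin 4 → ℂ :=
  ![
    t 0,
    1 / 3 * (10 * t 0 ^ 3 * t 1 - t 0 * t 2 - 3 * t 1 ^ 2),
    1 / 3 * (-100 * t 0 ^ 4 * t 1 ^ 2 + 20 * t 0 ^ 2 * t 1 * t 2 + 15 * t 0 * t 1 ^ 3 +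
      3 * t 3 - t 2 ^ 2),
    1 / 27 * (-2000 * t 0 ^ 6 * t 1 ^ 3 + 600 * t 0 ^ 4 * t 1 ^ 2 * t 2 +
      450 * t 0 ^ 3 * t 1 ^ 4 + 90 * t 0 ^ 2 * t 3 * t 1 - 60 * t 0 ^ 2 * t 1 * t 2 ^ 2 -
      45 * t 0 * t 1 ^ 3 * t 2 - 9 * t 3 * t 2 - 54 * t 1 ^ 5 + 2 * t 2 ^ 3)]

end H4Family

end

open H4Family MvPolynomial

open H4Family MvPolynomial

namespace H4Family

/-! ## Common eigenvectors -/

/-! The surface `z² = f(x, y)` is singular exactly when `f` has a critical point with critical value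
`0`, so the discriminant locus is the vanishing locus of a norm of `f`. For `H₄(0)`, put `w = t₁ y +
t₆`; then `∂f/∂x = 5 (w² + 3 x² w + x⁴)` is a product of two factors `w + k x²`, with `k` running
over the roots of `k² - 3 k + 1`. For each root, the critical points on that factor are the points
of an algebra with basis `1, x, y, x y`. The determinant of multiplication by `f` on it is `D /
729`, independent of the choice of `k` (`det_critF`). This determinant vanishes iff `f` vanishes at
a point of the algebra: evaluation at a point gives a common eigenvector of the multiplication
matrices, and conversely commuting matrices have a common eigenvector in the kernel of
multiplication by `f`.

Square-freeness is inherited from one univariate specialization, because the leading coefficient in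
the last parameter is a nonzero constant.

For `H₄(1)` no new critical algebra is needed. A translation of `(x, y)` turns the family into a
pull-back of the `H₄(0)` family, and `D_{H₄(0)}(u) = t₁₀² D_{H₄(1)}(t)`, so the reduced equation is
`t₁₀ D_{H₄(1)}`.

The potentials are quasi-homogeneous, so `E` multiplies each entry of the Hessian by its degree and
`det T` becomes an explicit polynomial. For `H₄(1)` everything is written in `(x₁, x₂, z, x₄)`:
differentiating along a branch divides by `2 z`, but in the gradient and in the Hessian these
divisions are exact, which is why `Δ` is one polynomial for all branches. -/

theorem exists_eigenvector_mem {V : Type*} [AddCommGroup V] [Module ℂ V] [FiniteDimensional ℂ V]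
    (f : Module.End ℂ V) (W : Submodule ℂ V) (hW : W ≠ ⊥) (hf : ∀ v ∈ W, f v ∈ W) :
    ∃ a : ℂ, ∃ v ∈ W, v ≠ 0 ∧ f v = a • v := by
  have : Nontrivial W := Submodule.nontrivial_iff_ne_bot.mpr hW
  obtain ⟨a, ha⟩ := Module.End.exists_eigenvalue (f.restrict hf)
  obtain ⟨v, hv⟩ := ha.exists_hasEigenvector
  exact ⟨a, v, v.2, fun h => hv.2 (Subtype.ext h), congrArg Subtype.val hv.apply_eq_smul⟩

theorem exists_common_eigenvector_mem {V : Type*} [AddCommGroup V] [Module ℂ V]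
    [FiniteDimensional ℂ V] (f g : Module.End ℂ V) (hfg : Commute f g) (W : Submodule ℂ V)
    (hW : W ≠ ⊥) (hf : ∀ v ∈ W, f v ∈ W) (hg : ∀ v ∈ W, g v ∈ W) :
    ∃ a b : ℂ, ∃ v ∈ W, v ≠ 0 ∧ f v = a • v ∧ g v = b • v := by
  obtain ⟨a, v, hvW, hv0, hv⟩ := exists_eigenvector_mem f W hW hf
  -- Since `g` commutes with `f`, it preserves the eigenspace of `f` inside `W`; an eigenvector of
  -- `g` there serves both.
  obtain ⟨b, w, hw, hw0, hgw⟩ := exists_eigenvector_mem g (W ⊓ f.eigenspace a)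
    (Submodule.ne_bot_iff _ |>.mpr
      ⟨v, ⟨hvW, Module.End.mem_eigenspace_iff.mpr hv⟩, hv0⟩)
    (fun u hu => ⟨hg u hu.1, by
      rw [SetLike.mem_coe, Module.End.mem_eigenspace_iff, ← Module.End.mul_apply, hfg.eq,
        Module.End.mul_apply, Module.End.mem_eigenspace_iff.mp hu.2, map_smul]⟩)
  exact ⟨a, b, w, hw.1, hw0, Module.End.mem_eigenspace_iff.mp hw.2, hgw⟩

/-- The kernel of `N` is nonzero and stable under everything that commutes with `N`. In the
application `N` is multiplication by `f`, and the eigenvalues `a`, `b` are the coordinates of a zero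
of `f`. -/
theorem exists_common_eigenvector_of_det_eq_zero {n : Type*} [Fintype n] [DecidableEq n]
    (A B N : Matrix n n ℂ) (hAB : A * B = B * A) (hA : A * N = N * A) (hB : B * N = N * B)
    (hN : N.det = 0) :
    ∃ a b : ℂ, ∃ v : n → ℂ, v ≠ 0 ∧ A.mulVec v = a • v ∧ B.mulVec v = b • v ∧ N.mulVec v = 0 := by
  obtain ⟨v, hv0, hv⟩ := Matrix.exists_mulVec_eq_zero_iff.mpr hN
  have key (M : Matrix n n ℂ) (hM : M * N = N * M) (u : n → ℂ)
      (hu : u ∈ LinearMap.ker N.mulVecLin) : M.mulVecLin u ∈ LinearMap.ker N.mulVecLin := by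
    rw [LinearMap.mem_ker, Matrix.mulVecLin_apply] at *
    rw [Matrix.mulVecLin_apply, Matrix.mulVec_mulVec, ← hM, ← Matrix.mulVec_mulVec, hu,
      Matrix.mulVec_zero]
  obtain ⟨a, b, w, hw, hw0, h1, h2⟩ := exists_common_eigenvector_mem A.mulVecLin B.mulVecLin
    (by
      refine LinearMap.ext fun u => ?_
      simp only [Module.End.mul_apply, Matrix.mulVecLin_apply, Matrix.mulVec_mulVec, hAB])
    (LinearMap.ker N.mulVecLin) ((Submodule.ne_bot_iff _).mpr ⟨v, hv, hv0⟩) (key A hA) (key B hB)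
  exact ⟨a, b, w, hw0, h1, h2, hw⟩

/-! ## Square-free polynomials -/

/-- If `p²` divides `D`, the leading coefficient of `p` divides a unit, so `p` keeps its degree
under specialization. There it becomes a unit, so the degree is `0` and `p` equals its own leading
coefficient. The left inverse `θ` carries this back to `S`. -/
theorem squarefree_of_leadingCoeff_isUnit {R S K : Type*} [CommRing R] [IsDomain R] [CommRing S]
    [Field K] (ψ : S →+* Polynomial R) (θ : Polynomial R →+* S) (hθ : ∀ p, θ (ψ p) = p)
    (e : R →+* K) (D : S) (hD : IsUnit (ψ D).leadingCoeff)
    (hsq : Squarefree ((ψ D).map e)) : Squarefree D := by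
  rintro p ⟨q, hq⟩
  have hψ : ψ D = ψ p * (ψ p * ψ q) := by rw [hq]; simp [mul_assoc]
  have hu : IsUnit (ψ p).leadingCoeff := by
    rw [hψ, Polynomial.leadingCoeff_mul] at hD
    exact isUnit_of_mul_isUnit_left hD
  have hm : IsUnit ((ψ p).map e) := hsq _ ⟨(ψ q).map e, by
    rw [hψ]; simp [Polynomial.map_mul, mul_assoc]⟩
  have hdeg : (ψ p).natDegree = 0 := by
    rw [← Polynomial.natDegree_map_of_leadingCoeff_ne_zero e (hu.map e).ne_zero]
    exact Polynomial.natDegree_eq_zero_of_isUnit hm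
  have hp : IsUnit (ψ p) := by
    rw [Polynomial.eq_C_of_natDegree_eq_zero hdeg, Polynomial.isUnit_C]
    rwa [Polynomial.leadingCoeff, hdeg] at hu
  rw [← hθ p]
  exact hp.map θ

/-- A polynomial in four variables, viewed as a univariate polynomial in the last one. -/
noncomputable def toLastVar :
    MvPolynomial (Fin 4) ℂ →ₐ[ℂ] Polynomial (MvPolynomial (Fin 3) ℂ) :=
  aeval ![Polynomial.C (X 0), Polynomial.C (X 1), Polynomial.C (X 2), Polynomial.X]

/-- The inverse of `toLastVar`. -/
noncomputable def ofLastVar :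
    Polynomial (MvPolynomial (Fin 3) ℂ) →+* MvPolynomial (Fin 4) ℂ :=
  Polynomial.eval₂RingHom (rename Fin.castSucc).toRingHom (X 3)

theorem ofLastVar_toLastVar (p : MvPolynomial (Fin 4) ℂ) : ofLastVar (toLastVar p) = p := by
  have : (ofLastVar.comp toLastVar.toRingHom) = RingHom.id _ := by
    refine MvPolynomial.ringHom_ext (fun r => ?_) (fun i => ?_)
    · simp [toLastVar, ofLastVar, Polynomial.algebraMap_apply, MvPolynomial.algebraMap_eq]
    · fin_cases i <;> simp [toLastVar, ofLastVar]
  exact congrArg (fun f => f p) this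

theorem squarefree_of_specialization (D : MvPolynomial (Fin 4) ℂ) (s : Fin 3 → ℂ)
    (hD : IsUnit (toLastVar D).leadingCoeff)
    (hsq : Squarefree ((toLastVar D).map (eval s))) : Squarefree D :=
  squarefree_of_leadingCoeff_isUnit toLastVar.toRingHom ofLastVar ofLastVar_toLastVar (eval s) D
    hD hsq

/-! ## Singular points of the surface `z² = f(x, y)` -/

/-- The derivative `2 z` forces `z = 0`; the remaining equations are those of a critical point of
`f` with value `0`. -/
theorem isSingularSurface_surface_iff (f : MvPolynomial (Fin 2) ℂ) :
    IsSingularSurface (surface f) ↔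
      ∃ p : Fin 2 → ℂ, eval p f = 0 ∧ eval p (pderiv 0 f) = 0 ∧ eval p (pderiv 1 f) = 0 := by
  have h2 : pderiv (2 : Fin 3) (rename Fin.castSucc f) = 0 := by
    refine pderiv_eq_zero_of_notMem_vars fun h => ?_
    obtain ⟨i, -, hi⟩ := Finset.mem_image.mp (vars_rename Fin.castSucc f h)
    exact (Fin.castSucc_lt_last i).ne hi
  have h0 : pderiv (0 : Fin 3) (rename Fin.castSucc f) = rename Fin.castSucc (pderiv 0 f) :=
    pderiv_rename (Fin.castSucc_injective 2) 0 f
  have h1 : pderiv (1 : Fin 3) (rename Fin.castSucc f) = rename Fin.castSucc (pderiv 1 f) :=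
    pderiv_rename (Fin.castSucc_injective 2) 1 f
  have e0 : pderiv (0 : Fin 3) (surface f) = -rename Fin.castSucc (pderiv 0 f) := by
    simp [surface, h0, pderiv_X_of_ne (by decide : (2 : Fin 3) ≠ 0)]
  have e1 : pderiv (1 : Fin 3) (surface f) = -rename Fin.castSucc (pderiv 1 f) := by
    simp [surface, h1, pderiv_X_of_ne (by decide : (2 : Fin 3) ≠ 1)]
  have e2 : pderiv (2 : Fin 3) (surface f) = 2 * X 2 := by
    simp [surface, h2]
  constructor
  · rintro ⟨p, hp, hd⟩
    have d0 := hd 0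
    have d1 := hd 1
    have d2 := hd 2
    rw [e0, map_neg, neg_eq_zero, eval_rename] at d0
    rw [e1, map_neg, neg_eq_zero, eval_rename] at d1
    rw [e2] at d2
    have hz : p 2 = 0 := by simpa using d2
    refine ⟨p ∘ Fin.castSucc, ?_, d0, d1⟩
    simpa [surface, eval_rename, hz] using hp
  · rintro ⟨p, hp, d0, d1⟩
    have hc : (![p 0, p 1, 0] : Fin 3 → ℂ) ∘ Fin.castSucc = p := by
      funext i; fin_cases i <;> rfl
    refine ⟨![p 0, p 1, 0], ?_, ?_⟩
    · simp [surface, eval_rename, hc, hp]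
    · intro i
      fin_cases i
      · change eval _ (pderiv 0 (surface f)) = 0
        rw [e0, map_neg, eval_rename, hc, d0, neg_zero]
      · change eval _ (pderiv 1 (surface f)) = 0
        rw [e1, map_neg, eval_rename, hc, d1, neg_zero]
      · change eval _ (pderiv 2 (surface f)) = 0
        rw [e2]; simp

/-! ## Derivatives of polynomial functions -/

theorem hasFDerivAt_eval {n : ℕ} (p : MvPolynomial (Fin n) ℂ) (x : Fin n → ℂ) :
    HasFDerivAt (fun x : Fin n → ℂ => eval x p)
      (∑ k, eval x (pderiv k p) • (ContinuousLinearMap.proj k : (Fin n → ℂ) →L[ℂ] ℂ)) x := by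
  induction p using MvPolynomial.induction_on with
  | C a =>
    simp only [eval_C]
    refine (hasFDerivAt_const a x).congr_fderiv ?_
    ext v
    simp
  | add p q hp hq =>
    simp only [map_add (eval _)]
    refine (hp.fun_add hq).congr_fderiv ?_
    ext v
    simp [add_mul, Finset.sum_add_distrib]
  | mul_X p i hp =>
    simp only [map_mul, eval_X]
    refine (hp.fun_mul (hasFDerivAt_apply i x)).congr_fderiv ?_
    ext v
    simp [Derivation.leibniz, pderiv_X, Pi.single_apply, add_mul, Finset.sum_add_distrib,
      Finset.mul_sum, apply_ite, ite_mul, mul_assoc]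

theorem pd_eval (j : Fin 4) (p : MvPolynomial (Fin 4) ℂ) :
    pd j (fun x => eval x p) = fun x => eval x (pderiv j p) := by
  funext x
  rw [pd, (hasFDerivAt_eval p x).fderiv]
  simp [Pi.single_apply]

theorem pd_eval_comp {n : ℕ} (j : Fin 4) (p : MvPolynomial (Fin n) ℂ)
    (σ : (Fin 4 → ℂ) → Fin n → ℂ) (x : Fin 4 → ℂ)
    (hσ : ∀ k, DifferentiableAt ℂ (fun y => σ y k) x) :
    pd j (fun y => eval (σ y) p) x =
      ∑ k, eval (σ x) (pderiv k p) * pd j (fun y => σ y k) x := by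
  have h := (hasFDerivAt_eval p (σ x)).comp x (hasFDerivAt_pi.mpr fun k => (hσ k).hasFDerivAt)
  rw [pd, show (fun y => eval (σ y) p) = (fun y => eval y p) ∘ fun y k => σ y k from rfl, h.fderiv]
  simp [pd]

/-- The equation of a branch holds only on `U`; openness is what allows it to be differentiated. -/
theorem pd_congr {U : Set (Fin 4 → ℂ)} (hU : IsOpen U) {F G : (Fin 4 → ℂ) → ℂ}
    (h : Set.EqOn F G U) (j : Fin 4) : Set.EqOn (pd j F) (pd j G) U := fun x hx => by
  rw [pd, pd, Filter.EventuallyEq.fderiv_eq (Filter.eventuallyEq_of_mem (hU.mem_nhds hx) h)]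

theorem pd_coord (j k : Fin 4) (x : Fin 4 → ℂ) :
    pd j (fun y => y k) x = if k = j then 1 else 0 := by
  rw [pd, (hasFDerivAt_apply k x).fderiv]
  simp [Pi.single_apply]

/-- The equation `h` of the double cover `z² = h(x₁, x₂, x₃, x₄)`. -/
noncomputable def coverPoly : MvPolynomial (Fin 4) ℂ :=
  X 2 + 4 * X 0 * (X 0 ^ 5 - 3 * X 1)

theorem eval_coverPoly (x : Fin 4 → ℂ) :
    eval x coverPoly = x 2 + 4 * x 0 * (x 0 ^ 5 - 3 * x 1) := by
  simp [coverPoly]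

/-- The gradient of `coverPoly` at `x`. -/
noncomputable def coverGrad (x : Fin 4 → ℂ) : Fin 4 → ℂ :=
  ![24 * x 0 ^ 5 - 12 * x 1, -12 * x 0, 1, 0]

theorem eval_pderiv_coverPoly (x : Fin 4 → ℂ) (j : Fin 4) :
    eval x (pderiv j coverPoly) = coverGrad x j := by
  have h3 (j : Fin 4) : pderiv j (3 : MvPolynomial (Fin 4) ℂ) = 0 := pderiv_C (a := 3)
  have h4 (j : Fin 4) : pderiv j (4 : MvPolynomial (Fin 4) ℂ) = 0 := pderiv_C (a := 4)
  fin_cases j <;>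
    simp [coverPoly, coverGrad, pderiv_X, Derivation.leibniz, h3, h4] <;> ring

/-- The point `(x₁, x₂, z, x₄)` above `x` determined by a branch `z`. -/
noncomputable def branchPoint (z : (Fin 4 → ℂ) → ℂ) (x : Fin 4 → ℂ) : Fin 4 → ℂ :=
  ![x 0, x 1, z x, x 3]

/-! ### Calculus along a branch of `z`. -/

namespace IsBranch

variable {U : Set (Fin 4 → ℂ)} {z : (Fin 4 → ℂ) → ℂ}

theorem sq_eq (h : IsBranch U z) {x : Fin 4 → ℂ} (hx : x ∈ U) :
    z x ^ 2 = eval x coverPoly := by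
  rw [eval_coverPoly]
  linear_combination h.2.2 x hx

theorem differentiableAt (h : IsBranch U z) {x : Fin 4 → ℂ} (hx : x ∈ U) :
    DifferentiableAt ℂ z x :=
  h.2.1.differentiableAt (h.1.mem_nhds hx)

theorem pd_sq (h : IsBranch U z) {x : Fin 4 → ℂ} (hx : x ∈ U) (j : Fin 4) :
    2 * z x * pd j z x = coverGrad x j := by
  have h1 := pd_congr h.1 (fun y hy => h.sq_eq hy) j hx
  have hz := (h.differentiableAt hx).hasFDerivAt
  simp only [H4Family.pd_eval, eval_pderiv_coverPoly, pow_two] at h1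
  rw [pd, (hz.fun_mul hz).fderiv] at h1
  rw [← h1]
  simp [pd, two_mul, add_mul]

/-- Differentiating `z² = h` in `x₃` gives `2 z ∂₃z = 1`, so a holomorphic branch never meets the
ramification locus. -/
theorem ne_zero (h : IsBranch U z) {x : Fin 4 → ℂ} (hx : x ∈ U) : z x ≠ 0 := fun h0 => by
  simpa [h0, coverGrad] using h.pd_sq hx 2

theorem pd_eq (h : IsBranch U z) {x : Fin 4 → ℂ} (hx : x ∈ U) (j : Fin 4) :
    pd j z x = coverGrad x j / (2 * z x) := by
  rw [eq_div_iff (mul_ne_zero two_ne_zero (h.ne_zero hx)), ← h.pd_sq hx j, mul_comm]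

/-- Chain rule for a polynomial in `(x₁, x₂, z, x₄)`: index `2` stands for `z`, so `x₃` acts only
through `z`, hence the case `j = 2`. -/
theorem pd_eval (h : IsBranch U z) {x : Fin 4 → ℂ} (hx : x ∈ U) (j : Fin 4)
    (p : MvPolynomial (Fin 4) ℂ) :
    pd j (fun y => eval (branchPoint z y) p) x =
      (if j = 2 then 0 else eval (branchPoint z x) (pderiv j p)) +
        eval (branchPoint z x) (pderiv 2 p) * (coverGrad x j / (2 * z x)) := by
  have hc (k : Fin 4) : DifferentiableAt ℂ (fun y : Fin 4 → ℂ => y k) x :=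
    (hasFDerivAt_apply k x).differentiableAt
  rw [pd_eval_comp j p (branchPoint z) x, Fin.sum_univ_four, ← h.pd_eq hx]
  · have h0 := pd_coord j 0 x
    have h1 := pd_coord j 1 x
    have h3 := pd_coord j 3 x
    simp only [branchPoint, Matrix.cons_val] at *
    rw [h0, h1, h3]
    fin_cases j <;> simp [add_comm]
  · intro k
    fin_cases k
    exacts [hc 0, hc 1, h.differentiableAt hx, hc 3]

/-- On the cover `z` has weight `3/10`, half the weight `3/5` of `z² = h`. -/
theorem euler_eval (h : IsBranch U z) {x : Fin 4 → ℂ} (hx : x ∈ U)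
    (p : MvPolynomial (Fin 4) ℂ) :
    euler wH4One (fun y => eval (branchPoint z y) p) x =
      1 / 10 * x 0 * eval (branchPoint z x) (pderiv 0 p) +
      1 / 2 * x 1 * eval (branchPoint z x) (pderiv 1 p) +
      3 / 10 * z x * eval (branchPoint z x) (pderiv 2 p) +
      x 3 * eval (branchPoint z x) (pderiv 3 p) := by
  have hz := h.ne_zero hx
  have hsq := h.2.2 x hx
  simp only [euler, Fin.sum_univ_four, h.pd_eval hx, wH4One, coverGrad, Matrix.cons_val]
  simp
  field_simp
  linear_combination (-60 * eval (branchPoint z x) (pderiv 2 p)) * hsq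

end IsBranch

theorem exists_isBranch (s : Fin 4 → ℂ) (hs : s 2 ≠ 0) :
    ∃ (U : Set (Fin 4 → ℂ)) (z : (Fin 4 → ℂ) → ℂ),
      IsBranch U z ∧ basePoint s ∈ U ∧ z (basePoint s) = s 2 := by
  have hd : Differentiable ℂ fun x : Fin 4 → ℂ => eval x coverPoly / s 2 ^ 2 := fun x => by
    simpa only [div_eq_mul_inv] using
      (hasFDerivAt_eval coverPoly x).differentiableAt.mul_const ((s 2 ^ 2)⁻¹)
  have hb : eval (basePoint s) coverPoly / s 2 ^ 2 = 1 := by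
    rw [div_eq_one_iff_eq (pow_ne_zero 2 hs), eval_coverPoly]
    simp [basePoint]
  -- The square root is `s₂ exp(½ log(h / s₂²))`: dividing by `s₂²` puts the value at the base point
  -- at `1`, inside the domain of the principal logarithm.
  refine ⟨{x | eval x coverPoly / s 2 ^ 2 ∈ Complex.slitPlane},
    fun x => s 2 * Complex.exp (2⁻¹ * Complex.log (eval x coverPoly / s 2 ^ 2)),
    ⟨Complex.isOpen_slitPlane.preimage hd.continuous, fun x hx => ?_, fun x hx => ?_⟩, ?_, ?_⟩
  · exact ((((hd x).clog hx).const_mul 2⁻¹).cexp.const_mul _).differentiableWithinAt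
  · have h0 : eval x coverPoly / s 2 ^ 2 ≠ 0 := Complex.slitPlane_ne_zero hx
    have h1 : (s 2 * Complex.exp (2⁻¹ * Complex.log (eval x coverPoly / s 2 ^ 2))) ^ 2 =
        eval x coverPoly := by
      rw [mul_pow, ← Complex.exp_nat_mul, Nat.cast_ofNat, mul_inv_cancel_left₀ two_ne_zero,
        Complex.exp_log h0]
      field_simp
    rw [h1, eval_coverPoly]
    ring
  · rw [Set.mem_ofPred_eq, hb]
    exact Complex.one_mem_slitPlane
  · simp only [hb]
    simp

/-- Laplace expansion along the first two rows, by complementary `2 × 2` minors. -/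
theorem det_fin_four {R : Type*} [CommRing R] (M : Matrix (Fin 4) (Fin 4) R) :
    M.det =
      (M 0 0 * M 1 1 - M 0 1 * M 1 0) * (M 2 2 * M 3 3 - M 2 3 * M 3 2) -
      (M 0 0 * M 1 2 - M 0 2 * M 1 0) * (M 2 1 * M 3 3 - M 2 3 * M 3 1) +
      (M 0 0 * M 1 3 - M 0 3 * M 1 0) * (M 2 1 * M 3 2 - M 2 2 * M 3 1) +
      (M 0 1 * M 1 2 - M 0 2 * M 1 1) * (M 2 0 * M 3 3 - M 2 3 * M 3 0) -
      (M 0 1 * M 1 3 - M 0 3 * M 1 1) * (M 2 0 * M 3 2 - M 2 2 * M 3 0) +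
      (M 0 2 * M 1 3 - M 0 3 * M 1 2) * (M 2 0 * M 3 1 - M 2 1 * M 3 0) := by
  simp [Matrix.det_succ_row_zero, Fin.sum_univ_succ, Fin.succAbove]
  ring

/-! ## Critical points of `f_{H₄(0)}`

The partial derivative `∂f/∂x = 5 ((t₁ y + t₆)² + 3 x² (t₁ y + t₆) + x⁴)` splits over `ℚ(√5)`. The
critical points with `t₁ y + t₆ = -k x²`, where `k² - 3 k + 1 = 0`, are the points of an algebra
with basis `1, x, y, x y`. -/

/-- Multiplication by `x` on `1, x, y, x y`. -/
noncomputable def critX (k t1 t6 t10 : ℂ) : Matrix (Fin 4) (Fin 4) ℂ :=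
  !![0, 1, 0, 0;
      -3 * t6 + t6 * k, 0, -3 * t1 + t1 * k, 0;
      0, 0, 0, 1;
      t1 * t10 - 1 / 3 * t1 * t10 * k, -10 / 3 * t1 ^ 2 * t6 + 5 / 3 * t1 ^ 2 * t6 * k, -3 *
      t6 + t6 * k, -10 / 3 * t1 ^ 3 + 5 / 3 * t1 ^ 3 * k]

/-- Multiplication by `y` on `1, x, y, x y`. -/
noncomputable def critY (k t1 t6 t10 : ℂ) : Matrix (Fin 4) (Fin 4) ℂ :=
  !![0, 0, 1, 0;
      0, 0, 0, 1;
      -1 / 3 * t10, 5 / 3 * t1 * t6 - 5 / 3 * t1 * t6 * k, 0, 5 / 3 * t1 ^ 2 - 5 / 3 * t1 ^ 2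
      * k;
      -10 / 3 * t1 * t6 ^ 2 + 5 / 3 * t1 * t6 ^ 2 * k + 10 / 9 * t1 ^ 3 * t10 - 5 / 9 * t1 ^ 3
      * t10 * k, -25 / 9 * t1 ^ 4 * t6 - 1 / 3 * t10, -20 / 3 * t1 ^ 2 * t6 + 10 / 3 * t1 ^ 2
      * t6 * k, -25 / 9 * t1 ^ 5]

/-- Multiplication by `f` on `1, x, y, x y`. -/
noncomputable def critF (k t1 t6 t10 t15 : ℂ) : Matrix (Fin 4) (Fin 4) ℂ :=
  !![5 / 9 * t1 ^ 3 * t6 ^ 2 - 5 / 27 * t1 ^ 5 * t10 + t15, 1 / 9 * t1 ^ 2 * t10 - 1 / 9 * t1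
      ^ 2 * t10 * k + 25 / 27 * t1 ^ 6 * t6 - 25 / 27 * t1 ^ 6 * t6 * k - 2 * t6 ^ 2 + 2 * t6
      ^ 2 * k, 10 / 9 * t1 ^ 4 * t6 + 2 / 3 * t10, -7 / 3 * t1 * t6 + 7 / 3 * t1 * t6 * k + 25
      / 27 * t1 ^ 7 - 25 / 27 * t1 ^ 7 * k;
      -16 / 9 * t1 ^ 2 * t6 * t10 + 8 / 9 * t1 ^ 2 * t6 * t10 * k - 50 / 27 * t1 ^ 6 * t6 ^ 2
      + 25 / 27 * t1 ^ 6 * t6 ^ 2 * k + 50 / 81 * t1 ^ 8 * t10 - 25 / 81 * t1 ^ 8 * t10 * k +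
      4 * t6 ^ 3 - 2 * t6 ^ 3 * k, 40 / 9 * t1 ^ 3 * t6 ^ 2 - 5 / 27 * t1 ^ 5 * t10 - 125 / 81
      * t1 ^ 9 * t6 + t15, 26 / 3 * t1 * t6 ^ 2 - 13 / 3 * t1 * t6 ^ 2 * k - 2 / 9 * t1 ^ 3 *
      t10 + 1 / 9 * t1 ^ 3 * t10 * k - 100 / 27 * t1 ^ 7 * t6 + 50 / 27 * t1 ^ 7 * t6 * k, 5 *
      t1 ^ 4 * t6 - 125 / 81 * t1 ^ 10 + 2 / 3 * t10;
      35 / 9 * t1 ^ 2 * t6 ^ 3 - 5 / 3 * t1 ^ 4 * t6 * t10 - 125 / 81 * t1 ^ 8 * t6 ^ 2 + 125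
      / 243 * t1 ^ 10 * t10 - 2 / 9 * t10 ^ 2, 17 / 9 * t1 * t6 * t10 - 17 / 9 * t1 * t6 * t10
      * k + 25 / 3 * t1 ^ 5 * t6 ^ 2 - 25 / 3 * t1 ^ 5 * t6 ^ 2 * k - 25 / 81 * t1 ^ 7 * t10 +
      25 / 81 * t1 ^ 7 * t10 * k - 625 / 243 * t1 ^ 11 * t6 + 625 / 243 * t1 ^ 11 * t6 * k, 25
      / 3 * t1 ^ 3 * t6 ^ 2 - 5 / 27 * t1 ^ 5 * t10 - 250 / 81 * t1 ^ 9 * t6 + t15, 11 / 9 *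
      t1 ^ 2 * t10 - 11 / 9 * t1 ^ 2 * t10 * k + 250 / 27 * t1 ^ 6 * t6 - 250 / 27 * t1 ^ 6 *
      t6 * k - 625 / 243 * t1 ^ 12 + 625 / 243 * t1 ^ 12 * k - 2 * t6 ^ 2 + 2 * t6 ^ 2 * k;
      -46 / 9 * t1 * t6 ^ 2 * t10 + 23 / 9 * t1 * t6 ^ 2 * t10 * k + 22 / 27 * t1 ^ 3 * t10 ^
      2 - 11 / 27 * t1 ^ 3 * t10 ^ 2 * k - 50 / 3 * t1 ^ 5 * t6 ^ 3 + 25 / 3 * t1 ^ 5 * t6 ^ 3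
      * k + 550 / 81 * t1 ^ 7 * t6 * t10 - 275 / 81 * t1 ^ 7 * t6 * t10 * k + 1250 / 243 * t1
      ^ 11 * t6 ^ 2 - 625 / 243 * t1 ^ 11 * t6 ^ 2 * k - 1250 / 729 * t1 ^ 13 * t10 + 625 /
      729 * t1 ^ 13 * t10 * k, 65 / 9 * t1 ^ 2 * t6 ^ 3 - 100 / 27 * t1 ^ 4 * t6 * t10 - 1375
      / 81 * t1 ^ 8 * t6 ^ 2 + 125 / 243 * t1 ^ 10 * t10 + 3125 / 729 * t1 ^ 14 * t6 - 2 / 9 *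
      t10 ^ 2, -56 / 9 * t1 ^ 2 * t6 * t10 + 28 / 9 * t1 ^ 2 * t6 * t10 * k - 950 / 27 * t1 ^
      6 * t6 ^ 2 + 475 / 27 * t1 ^ 6 * t6 ^ 2 * k + 50 / 81 * t1 ^ 8 * t10 - 25 / 81 * t1 ^ 8
      * t10 * k + 2500 / 243 * t1 ^ 12 * t6 - 1250 / 243 * t1 ^ 12 * t6 * k + 4 * t6 ^ 3 - 2 *
      t6 ^ 3 * k, 35 / 3 * t1 ^ 3 * t6 ^ 2 - 20 / 9 * t1 ^ 5 * t10 - 500 / 27 * t1 ^ 9 * t6 +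
      3125 / 729 * t1 ^ 15 + t15]

/-- The commutator vanishes only modulo the equation of `k`, so the cofactor of `k² - 3 k + 1` is
written out. -/
theorem critX_mul_critY (k t1 t6 t10 : ℂ) (hk : k ^ 2 - 3 * k + 1 = 0) :
    critX k t1 t6 t10 * critY k t1 t6 t10 = critY k t1 t6 t10 * critX k t1 t6 t10 := by
  have h : critX k t1 t6 t10 * critY k t1 t6 t10 - critY k t1 t6 t10 * critX k t1 t6 t10 =
      (k ^ 2 - 3 * k + 1) •
      !![0, 0, 0, 0;
      0, -5 / 3 * t1 ^ 2 * t6, 0, -5 / 3 * t1 ^ 3;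
      5 / 3 * t1 * t6 ^ 2 - 5 / 9 * t1 ^ 3 * t10, 25 / 9 * t1 ^ 4 * t6, 10 / 3 * t1 ^ 2 * t6,
      25 / 9 * t1 ^ 5;
      25 / 9 * t1 ^ 4 * t6 ^ 2 - 25 / 27 * t1 ^ 6 * t10, -5 / 3 * t1 * t6 ^ 2, 50 / 9 * t1 ^ 5
      * t6, -5 / 3 * t1 ^ 2 * t6] := by
    ext i j
    fin_cases i <;> fin_cases j <;> simp [critX, critY] <;> ring
  rwa [hk, zero_smul, sub_eq_zero] at h

-- The first row of `critF` holds the coordinates of `f` in the basis `1, x, y, x y`. Hence `critF`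
-- is a polynomial in `critX` and `critY`, and commutes with both.
set_option maxHeartbeats 1000000 in
theorem critF_eq (k t1 t6 t10 t15 : ℂ) (hk : k ^ 2 - 3 * k + 1 = 0) :
    critF k t1 t6 t10 t15 =
      critF k t1 t6 t10 t15 0 0 • 1 + critF k t1 t6 t10 t15 0 1 • critX k t1 t6 t10 +
      critF k t1 t6 t10 t15 0 2 • critY k t1 t6 t10 +
      critF k t1 t6 t10 t15 0 3 • (critX k t1 t6 t10 * critY k t1 t6 t10) := by
  have h : critF k t1 t6 t10 t15 0 0 • 1 + critF k t1 t6 t10 t15 0 1 • critX k t1 t6 t10 +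
      critF k t1 t6 t10 t15 0 2 • critY k t1 t6 t10 +
      critF k t1 t6 t10 t15 0 3 • (critX k t1 t6 t10 * critY k t1 t6 t10) -
      critF k t1 t6 t10 t15 = (k ^ 2 - 3 * k + 1) •
      !![0, 0, 0, 0;
      -8 / 9 * t1 ^ 2 * t6 * t10 - 25 / 27 * t1 ^ 6 * t6 ^ 2 + 25 / 81 * t1 ^ 8 * t10 + 2 * t6
      ^ 3, 70 / 9 * t1 ^ 3 * t6 ^ 2 - 35 / 9 * t1 ^ 3 * t6 ^ 2 * k - 250 / 81 * t1 ^ 9 * t6 +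
      125 / 81 * t1 ^ 9 * t6 * k, 13 / 3 * t1 * t6 ^ 2 - 1 / 9 * t1 ^ 3 * t10 - 50 / 27 * t1 ^
      7 * t6, 70 / 9 * t1 ^ 4 * t6 - 35 / 9 * t1 ^ 4 * t6 * k - 250 / 81 * t1 ^ 10 + 125 / 81
      * t1 ^ 10 * k;
      35 / 9 * t1 ^ 2 * t6 ^ 3 - 35 / 27 * t1 ^ 4 * t6 * t10 - 125 / 81 * t1 ^ 8 * t6 ^ 2 +
      125 / 243 * t1 ^ 10 * t10, 0, 70 / 9 * t1 ^ 3 * t6 ^ 2 - 250 / 81 * t1 ^ 9 * t6, 0;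
      -13 / 9 * t1 * t6 ^ 2 * t10 + 1 / 27 * t1 ^ 3 * t10 ^ 2 - 350 / 27 * t1 ^ 5 * t6 ^ 3 +
      175 / 27 * t1 ^ 5 * t6 ^ 3 * k + 400 / 81 * t1 ^ 7 * t6 * t10 - 175 / 81 * t1 ^ 7 * t6 *
      t10 * k + 1250 / 243 * t1 ^ 11 * t6 ^ 2 - 625 / 243 * t1 ^ 11 * t6 ^ 2 * k - 1250 / 729
      * t1 ^ 13 * t10 + 625 / 729 * t1 ^ 13 * t10 * k, 100 / 9 * t1 ^ 2 * t6 ^ 3 - 35 / 9 * t1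
      ^ 2 * t6 ^ 3 * k - 40 / 27 * t1 ^ 4 * t6 * t10 - 1250 / 81 * t1 ^ 8 * t6 ^ 2 + 125 / 81
      * t1 ^ 8 * t6 ^ 2 * k + 125 / 243 * t1 ^ 10 * t10 + 3125 / 729 * t1 ^ 14 * t6, -8 / 9 *
      t1 ^ 2 * t6 * t10 - 725 / 27 * t1 ^ 6 * t6 ^ 2 + 350 / 27 * t1 ^ 6 * t6 ^ 2 * k + 25 /
      81 * t1 ^ 8 * t10 + 2500 / 243 * t1 ^ 12 * t6 - 1250 / 243 * t1 ^ 12 * t6 * k + 2 * t6 ^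
      3, 15 * t1 ^ 3 * t6 ^ 2 - 35 / 9 * t1 ^ 3 * t6 ^ 2 * k - 5 / 27 * t1 ^ 5 * t10 - 1375 /
      81 * t1 ^ 9 * t6 + 125 / 81 * t1 ^ 9 * t6 * k + 3125 / 729 * t1 ^ 15] := by
    ext i j
    simp only [Matrix.sub_apply, Matrix.add_apply, Matrix.smul_apply, Matrix.mul_apply,
      Fin.sum_univ_four, smul_eq_mul, Matrix.one_apply]
    fin_cases i <;> fin_cases j <;>
      simp only [critF, critX, critY, Matrix.of_apply, Matrix.cons_val, Fin.reduceFinMk,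
        Fin.zero_eta, Fin.mk_one, Fin.reduceEq, if_true, if_false] <;> ring
  rw [hk, zero_smul, sub_eq_zero] at h
  exact h.symm

-- This is the norm of `f` from the critical algebra. Modulo the equation of `k` the result no
-- longer contains `k`, so either root detects all of the discriminant; `729` is the coefficient of
-- `t₁₅⁴` in `D`.
set_option maxHeartbeats 4000000 in
theorem det_critF (k t1 t6 t10 t15 : ℂ) (hk : k ^ 2 - 3 * k + 1 = 0) :
    (critF k t1 t6 t10 t15).det = 1 / 729 * exprDH4Zero t1 t6 t10 t15 := by
  rw [det_fin_four]
  simp only [critF, exprDH4Zero, Matrix.of_apply, Matrix.cons_val]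
  linear_combination (
    160 / 9 * t1 * t6 ^ 4 * t10 ^ 2 * t15 - 670 / 27 * t1 ^ 2 * t6 ^ 3 * t10 * t15 ^ 2 + 3080 /
    729 * t1 ^ 2 * t6 ^ 3 * t10 ^ 4 + 2360 / 27 * t1 ^ 2 * t6 ^ 8 * t10 - 520 / 9 * t1 ^ 2 * t6
    ^ 8 * t10 * k + 520 / 27 * t1 ^ 2 * t6 ^ 8 * t10 * k ^ 2 - 320 / 27 * t1 ^ 3 * t6 ^ 2 * t10
    ^ 3 * t15 - 1300 / 27 * t1 ^ 3 * t6 ^ 7 * t15 + 410 / 81 * t1 ^ 4 * t6 * t10 ^ 2 * t15 ^ 2 -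
    1240 / 2187 * t1 ^ 4 * t6 * t10 ^ 5 + 40555 / 729 * t1 ^ 4 * t6 ^ 6 * t10 ^ 2 - 6385 / 243 *
    t1 ^ 4 * t6 ^ 6 * t10 ^ 2 * k + 6385 / 729 * t1 ^ 4 * t6 ^ 6 * t10 ^ 2 * k ^ 2 - 1175 / 81 *
    t1 ^ 5 * t6 ^ 5 * t10 * t15 + 32 / 81 * t1 ^ 5 * t10 ^ 4 * t15 + 26185 / 729 * t1 ^ 6 * t6 ^
    4 * t10 ^ 3 - 1345 / 243 * t1 ^ 6 * t6 ^ 4 * t10 ^ 3 * k + 1345 / 729 * t1 ^ 6 * t6 ^ 4 *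
    t10 ^ 3 * k ^ 2 - 3050 / 27 * t1 ^ 6 * t6 ^ 4 * t15 ^ 2 - 13925 / 729 * t1 ^ 6 * t6 ^ 9 +
    200 / 9 * t1 ^ 6 * t6 ^ 9 * k - 200 / 27 * t1 ^ 6 * t6 ^ 9 * k ^ 2 - 29150 / 243 * t1 ^ 7 *
    t6 ^ 3 * t10 ^ 2 * t15 + 1850 / 27 * t1 ^ 8 * t6 ^ 2 * t10 * t15 ^ 2 - 16345 / 2187 * t1 ^ 8
    * t6 ^ 2 * t10 ^ 4 - 385 / 729 * t1 ^ 8 * t6 ^ 2 * t10 ^ 4 * k + 385 / 2187 * t1 ^ 8 * t6 ^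
    2 * t10 ^ 4 * k ^ 2 + 28675 / 2187 * t1 ^ 8 * t6 ^ 7 * t10 + 5950 / 243 * t1 ^ 8 * t6 ^ 7 *
    t10 * k - 5950 / 729 * t1 ^ 8 * t6 ^ 7 * t10 * k ^ 2 + 1975 / 243 * t1 ^ 9 * t6 * t10 ^ 3 *
    t15 - 96250 / 729 * t1 ^ 9 * t6 ^ 6 * t15 + 22525 / 2187 * t1 ^ 10 * t6 ^ 5 * t10 ^ 2 + 2350
    / 243 * t1 ^ 10 * t6 ^ 5 * t10 ^ 2 * k - 2350 / 729 * t1 ^ 10 * t6 ^ 5 * t10 ^ 2 * k ^ 2 -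
    200 / 243 * t1 ^ 10 * t10 ^ 2 * t15 ^ 2 + 1213 / 19683 * t1 ^ 10 * t10 ^ 5 - 121 / 6561 * t1
    ^ 10 * t10 ^ 5 * k + 121 / 19683 * t1 ^ 10 * t10 ^ 5 * k ^ 2 - 465125 / 2187 * t1 ^ 11 * t6
    ^ 4 * t10 * t15 - 698575 / 19683 * t1 ^ 12 * t6 ^ 3 * t10 ^ 3 + 1150 / 729 * t1 ^ 12 * t6 ^
    3 * t10 ^ 3 * k - 1150 / 2187 * t1 ^ 12 * t6 ^ 3 * t10 ^ 3 * k ^ 2 + 160000 / 729 * t1 ^ 12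
    * t6 ^ 3 * t15 ^ 2 - 6875 / 2187 * t1 ^ 12 * t6 ^ 8 - 625 / 243 * t1 ^ 12 * t6 ^ 8 * k + 625
    / 729 * t1 ^ 12 * t6 ^ 8 * k ^ 2 + 149000 / 2187 * t1 ^ 13 * t6 ^ 2 * t10 ^ 2 * t15 - 51250
    / 2187 * t1 ^ 14 * t6 * t10 * t15 ^ 2 + 121450 / 59049 * t1 ^ 14 * t6 * t10 ^ 4 + 550 / 6561
    * t1 ^ 14 * t6 * t10 ^ 4 * k - 550 / 19683 * t1 ^ 14 * t6 * t10 ^ 4 * k ^ 2 - 675625 / 19683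
    * t1 ^ 14 * t6 ^ 6 * t10 - 625 / 243 * t1 ^ 14 * t6 ^ 6 * t10 * k + 625 / 729 * t1 ^ 14 * t6
    ^ 6 * t10 * k ^ 2 + 203125 / 2187 * t1 ^ 15 * t6 ^ 5 * t15 - 29125 / 19683 * t1 ^ 15 * t10 ^
    3 * t15 - 428125 / 19683 * t1 ^ 16 * t6 ^ 4 * t10 ^ 2 - 625 / 729 * t1 ^ 16 * t6 ^ 4 * t10 ^
    2 * k + 625 / 2187 * t1 ^ 16 * t6 ^ 4 * t10 ^ 2 * k ^ 2 + 2506250 / 19683 * t1 ^ 17 * t6 ^ 3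
    * t10 * t15 + 25625 / 2187 * t1 ^ 18 * t6 ^ 2 * t10 ^ 3 - 625 / 6561 * t1 ^ 18 * t6 ^ 2 *
    t10 ^ 3 * k + 625 / 19683 * t1 ^ 18 * t6 ^ 2 * t10 ^ 3 * k ^ 2 - 218750 / 2187 * t1 ^ 18 *
    t6 ^ 2 * t15 ^ 2 + 78125 / 59049 * t1 ^ 18 * t6 ^ 7 - 284375 / 19683 * t1 ^ 19 * t6 * t10 ^
    2 * t15 + 390625 / 59049 * t1 ^ 20 * t6 ^ 5 * t10 + 31250 / 19683 * t1 ^ 20 * t10 * t15 ^ 2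
    - 5000 / 59049 * t1 ^ 20 * t10 ^ 4 - 859375 / 59049 * t1 ^ 21 * t6 ^ 4 * t15 + 78125 / 19683
    * t1 ^ 22 * t6 ^ 3 * t10 ^ 2 - 1093750 / 59049 * t1 ^ 23 * t6 ^ 2 * t10 * t15 - 78125 /
    59049 * t1 ^ 24 * t6 * t10 ^ 3 + 781250 / 59049 * t1 ^ 24 * t6 * t15 ^ 2 + 78125 / 59049 *
    t1 ^ 25 * t10 ^ 2 * t15 - 32 / 27 * t6 ^ 5 * t10 ^ 3 + 8 * t6 ^ 5 * t15 ^ 2 + 48 * t6 ^ 10 -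
    48 * t6 ^ 10 * k + 16 * t6 ^ 10 * k ^ 2) * hk

/-- The equations of a point of the critical algebra. -/
structure IsCritPoint (k t1 t6 t10 x y : ℂ) : Prop where
  sq_root : k ^ 2 - 3 * k + 1 = 0
  sq_x : x ^ 2 = (k - 3) * (t1 * y + t6)
  -- This is `∂f/∂y = 0` after eliminating `x³` by `sq_x`; modulo `sq_root`, `(5 - 10 k) (k - 3) = 5
  -- (k - 1)`.
  sq_y : y ^ 2 = -1 / 3 * ((5 - 10 * k) * t1 * (k - 3) * (t1 * x * y + t6 * x) + t10)

theorem IsCritPoint.eval_f {k t1 t6 t10 x y : ℂ} (h : IsCritPoint k t1 t6 t10 x y) (t15 : ℂ) :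
    exprFH4Zero t1 t6 t10 t15 x y =
      critF k t1 t6 t10 t15 0 0 + critF k t1 t6 t10 t15 0 1 * x +
      critF k t1 t6 t10 t15 0 2 * y + critF k t1 t6 t10 t15 0 3 * (x * y) := by
  simp only [critF, exprFH4Zero, Matrix.of_apply, Matrix.cons_val]
  linear_combination (
    t1 * k * x * y + 2 * t1 * x * y - 5 / 9 * t1 ^ 3 * t6 * k - 5 / 9 * t1 ^ 4 * k * y + t6 * k
    * x + 2 * t6 * x + x ^ 3) * h.sq_x + (
    1 / 3 * t1 ^ 2 * k * x - 1 / 3 * t1 ^ 2 * x + 5 / 9 * t1 ^ 5 + y) * h.sq_y + (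
    16 / 3 * t1 * t6 * x * y + 13 / 3 * t1 ^ 2 * x * y ^ 2 + 10 / 9 * t1 ^ 3 * t6 * k * x ^ 2 -
    5 / 3 * t1 ^ 3 * t6 * x ^ 2 - 5 / 9 * t1 ^ 3 * t6 ^ 2 - 10 / 9 * t1 ^ 4 * t6 * y + 10 / 9 *
    t1 ^ 4 * k * x ^ 2 * y - 5 / 3 * t1 ^ 4 * x ^ 2 * y - 5 / 9 * t1 ^ 5 * y ^ 2 + 50 / 27 * t1
    ^ 6 * t6 * x + 50 / 27 * t1 ^ 7 * x * y + t6 ^ 2 * x) * h.sq_root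

theorem IsCritPoint.critX_mulVec {k t1 t6 t10 x y : ℂ} (h : IsCritPoint k t1 t6 t10 x y) :
    (critX k t1 t6 t10).mulVec ![1, x, y, x * y] = x • ![1, x, y, x * y] := by
  ext i
  fin_cases i <;> simp [critX, Matrix.mulVec, dotProduct, Fin.sum_univ_succ]
  · linear_combination -h.sq_x
  · linear_combination (-y) * h.sq_x - (-3 * t1 + t1 * k) * h.sq_y -
      (10 / 3 * t1 ^ 2 * t6 * k * x - 35 / 3 * t1 ^ 2 * t6 * x + 10 / 3 * t1 ^ 3 * k * x * y - 35 / 3 * t1 ^ 3 * x * y) *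
        h.sq_root

theorem IsCritPoint.critY_mulVec {k t1 t6 t10 x y : ℂ} (h : IsCritPoint k t1 t6 t10 x y) :
    (critY k t1 t6 t10).mulVec ![1, x, y, x * y] = y • ![1, x, y, x * y] := by
  ext i
  fin_cases i <;> simp [critY, Matrix.mulVec, dotProduct, Fin.sum_univ_succ]
  · ring
  · linear_combination -h.sq_y - (10 / 3 * t1 * t6 * x + 10 / 3 * t1 ^ 2 * x * y) * h.sq_root
  · linear_combination (-(5 / 3 * t1 * t6 - 5 / 3 * t1 * t6 * k - 5 / 3 * t1 ^ 2 * k * y + 5 / 3 * t1 ^ 2 * y)) * h.sq_x -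
      (-10 / 3 * t1 ^ 3 + 5 / 3 * t1 ^ 3 * k + x) * h.sq_y -
      (
    10 / 3 * t1 * t6 * x ^ 2 - 5 / 3 * t1 * t6 ^ 2 - 10 / 3 * t1 ^ 2 * t6 * y + 10 / 3 * t1 ^ 2
    * x ^ 2 * y - 5 / 3 * t1 ^ 3 * y ^ 2 + 50 / 9 * t1 ^ 4 * t6 * k * x - 125 / 9 * t1 ^ 4 * t6
    * x + 50 / 9 * t1 ^ 5 * k * x * y - 125 / 9 * t1 ^ 5 * x * y) * h.sq_root

/-- The vector `(1, x, y, x y)` of values of the basis at the point is an eigenvector of `critF`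
with eigenvalue `f(x, y) = 0`. -/
theorem IsCritPoint.det_critF_eq_zero {k t1 t6 t10 t15 x y : ℂ}
    (h : IsCritPoint k t1 t6 t10 x y) (hf : exprFH4Zero t1 t6 t10 t15 x y = 0) :
    (critF k t1 t6 t10 t15).det = 0 := by
  refine Matrix.exists_mulVec_eq_zero_iff.mp ⟨![1, x, y, x * y], fun h0 => ?_, ?_⟩
  · simpa using congrFun h0 0
  · rw [critF_eq _ _ _ _ _ h.sq_root]
    simp only [Matrix.add_mulVec, Matrix.smul_mulVec, ← Matrix.mulVec_mulVec, Matrix.one_mulVec,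
      h.critX_mulVec, h.critY_mulVec, Matrix.mulVec_smul, smul_smul, ← add_smul]
    rw [h.eval_f] at hf
    convert zero_smul ℂ _ using 2
    linear_combination hf

/-- A common eigenvector in the kernel is a multiple of `(1, x, y, x y)`, with `x`, `y` the
eigenvalues. Its rows then give the equations of the algebra and `f(x, y) = 0`. -/
theorem exists_isCritPoint_of_det_eq_zero {k t1 t6 t10 t15 : ℂ} (hk : k ^ 2 - 3 * k + 1 = 0)
    (hdet : (critF k t1 t6 t10 t15).det = 0) :
    ∃ x y, IsCritPoint k t1 t6 t10 x y ∧ exprFH4Zero t1 t6 t10 t15 x y = 0 := by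
  have hXY := critX_mul_critY k t1 t6 t10 hk
  have hF := critF_eq k t1 t6 t10 t15 hk
  have hXF : Commute (critX k t1 t6 t10) (critF k t1 t6 t10 t15) := by
    have hc : Commute (critX k t1 t6 t10) (critY k t1 t6 t10) := hXY
    rw [hF]
    exact ((((Commute.one_right _).smul_right _).add_right ((Commute.refl _).smul_right _)).add_right
      (hc.smul_right _)).add_right (((Commute.refl _).mul_right hc).smul_right _)
  have hYF : Commute (critY k t1 t6 t10) (critF k t1 t6 t10 t15) := by
    have hc : Commute (critY k t1 t6 t10) (critX k t1 t6 t10) := hXY.symm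
    rw [hF]
    exact ((((Commute.one_right _).smul_right _).add_right (hc.smul_right _)).add_right
      ((Commute.refl _).smul_right _)).add_right ((hc.mul_right (Commute.refl _)).smul_right _)
  obtain ⟨x, y, v, hv0, hX, hY, hFv⟩ :=
    exists_common_eigenvector_of_det_eq_zero _ _ _ hXY hXF hYF hdet
  have x0 := congrFun hX 0
  have x1 := congrFun hX 1
  have x2 := congrFun hX 2
  have y0 := congrFun hY 0
  have y2 := congrFun hY 2
  have f0 := congrFun hFv 0
  simp [critX, Matrix.mulVec, dotProduct, Fin.sum_univ_succ] at x0 x1 x2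
  simp [critY, Matrix.mulVec, dotProduct, Fin.sum_univ_succ] at y0 y2
  simp only [Matrix.mulVec, dotProduct, Fin.sum_univ_four, Pi.zero_apply] at f0
  -- The unit rows of `critX` and `critY` give `v₁ = x v₀`, `v₂ = y v₀`, `v₃ = x v₂`, so `v₀ = 0`
  -- would force `v = 0`.
  have hne : v 0 ≠ 0 := fun h0 => hv0 <| by
    have h1 : v 1 = 0 := by rw [x0, h0, mul_zero]
    have h2 : v 2 = 0 := by rw [y0, h0, mul_zero]
    have h3 : v 3 = 0 := by rw [x2, h2, mul_zero]
    funext i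
    fin_cases i
    exacts [h0, h1, h2, h3]
  rw [x0, y0] at x1
  rw [x2, x0, y0] at y2 f0
  have h : IsCritPoint k t1 t6 t10 x y := by
    refine ⟨hk, mul_right_cancel₀ hne ?_, mul_right_cancel₀ hne ?_⟩
    · linear_combination -x1
    · linear_combination -y2 - v 0 * (10 / 3 * t1 * t6 * x + 10 / 3 * t1 ^ 2 * x * y) * hk
  refine ⟨x, y, h, mul_right_cancel₀ hne ?_⟩
  rw [h.eval_f]
  linear_combination f0

theorem IsCritPoint.pderiv_x {k t1 t6 t10 x y : ℂ} (h : IsCritPoint k t1 t6 t10 x y) :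
    5 * x ^ 4 + 5 * t6 ^ 2 + 15 * t6 * x ^ 2 + y * (10 * t1 * t6 + 15 * t1 * x ^ 2) +
      5 * t1 ^ 2 * y ^ 2 = 0 := by
  linear_combination (5 * t1 * k * y + 5 * t6 * k + 5 * x ^ 2) * h.sq_x +
    (10 * t1 * t6 * y + 5 * t1 ^ 2 * y ^ 2 + 5 * t6 ^ 2) * h.sq_root

theorem IsCritPoint.pderiv_y {k t1 t6 t10 x y : ℂ} (h : IsCritPoint k t1 t6 t10 x y) :
    10 * t1 * t6 * x + 5 * t1 * x ^ 3 + t10 + 10 * t1 ^ 2 * x * y + 3 * y ^ 2 = 0 := by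
  linear_combination (5 * t1 * x) * h.sq_x + (3) * h.sq_y +
    (10 * t1 * t6 * x + 10 * t1 ^ 2 * x * y) * h.sq_root

/-- With `r² = 5`, the factorization of `∂f/∂x` has `k = (3 ± r) / 2`, and every critical point lies
on one of the two factors. The form of `sq_x` uses `k (3 - k) = 1`. -/
theorem exists_isCritPoint {t1 t6 t10 x y : ℂ}
    (hx : 5 * x ^ 4 + 5 * t6 ^ 2 + 15 * t6 * x ^ 2 + y * (10 * t1 * t6 + 15 * t1 * x ^ 2) +
      5 * t1 ^ 2 * y ^ 2 = 0)
    (hy : 10 * t1 * t6 * x + 5 * t1 * x ^ 3 + t10 + 10 * t1 ^ 2 * x * y + 3 * y ^ 2 = 0) :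
    ∃ k, IsCritPoint k t1 t6 t10 x y := by
  obtain ⟨r, hr⟩ := IsAlgClosed.exists_pow_nat_eq (5 : ℂ) (n := 2) (by norm_num)
  have key (k : ℂ) (hk : k ^ 2 - 3 * k + 1 = 0) (hw : t1 * y + t6 + k * x ^ 2 = 0) :
      IsCritPoint k t1 t6 t10 x y := by
    have hx2 : x ^ 2 = (k - 3) * (t1 * y + t6) := by
      linear_combination x ^ 2 * hk + (3 - k) * hw
    refine ⟨hk, hx2, ?_⟩
    linear_combination 1 / 3 * hy - 1 / 3 * (5 * t1 * x) * hx2 -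
      1 / 3 * (10 * t1 * t6 * x + 10 * t1 ^ 2 * x * y) * hk
  have hmul : (t1 * y + t6 + (3 + r) / 2 * x ^ 2) * (t1 * y + t6 + (3 - r) / 2 * x ^ 2) = 0 := by
    linear_combination 1 / 5 * hx - 1 / 4 * x ^ 4 * hr
  rcases mul_eq_zero.mp hmul with hw | hw
  · exact ⟨_, key _ (by linear_combination 1 / 4 * hr) hw⟩
  · exact ⟨_, key _ (by linear_combination 1 / 4 * hr) hw⟩

theorem eval_fH4Zero (t : Fin 4 → ℂ) (p : Fin 2 → ℂ) :
    eval p (fH4Zero t) = exprFH4Zero (t 0) (t 1) (t 2) (t 3) (p 0) (p 1) := by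
  simp [fH4Zero, exprFH4Zero]

theorem eval_pderiv_zero_fH4Zero (t : Fin 4 → ℂ) (p : Fin 2 → ℂ) :
    eval p (pderiv 0 (fH4Zero t)) =
      5 * p 0 ^ 4 + 5 * t 1 ^ 2 + 15 * t 1 * p 0 ^ 2 +
      p 1 * (10 * t 0 * t 1 + 15 * t 0 * p 0 ^ 2) + 5 * t 0 ^ 2 * p 1 ^ 2 := by
  have h5 : pderiv (0 : Fin 2) (5 : MvPolynomial (Fin 2) ℂ) = 0 := pderiv_C (a := 5)
  have h10 : pderiv (0 : Fin 2) (10 : MvPolynomial (Fin 2) ℂ) = 0 := pderiv_C (a := 10)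
  simp [fH4Zero, exprFH4Zero, pderiv_X, Derivation.leibniz, h5, h10]
  ring

theorem eval_pderiv_one_fH4Zero (t : Fin 4 → ℂ) (p : Fin 2 → ℂ) :
    eval p (pderiv 1 (fH4Zero t)) =
      10 * t 0 * t 1 * p 0 + 5 * t 0 * p 0 ^ 3 + t 2 + 10 * t 0 ^ 2 * p 0 * p 1 +
      3 * p 1 ^ 2 := by
  have h5 : pderiv (1 : Fin 2) (5 : MvPolynomial (Fin 2) ℂ) = 0 := pderiv_C (a := 5)
  have h10 : pderiv (1 : Fin 2) (10 : MvPolynomial (Fin 2) ℂ) = 0 := pderiv_C (a := 10)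
  simp [fH4Zero, exprFH4Zero, pderiv_X, Derivation.leibniz, h5, h10]
  ring

theorem eval_polyDH4Zero (t : Fin 4 → ℂ) :
    eval t polyDH4Zero = exprDH4Zero (t 0) (t 1) (t 2) (t 3) := by
  simp [polyDH4Zero, exprDH4Zero]

theorem mem_discriminantLocus_fH4Zero (t : Fin 4 → ℂ) :
    t ∈ discriminantLocus fH4Zero ↔ eval t polyDH4Zero = 0 := by
  rw [discriminantLocus, Set.mem_ofPred_eq, isSingularSurface_surface_iff, eval_polyDH4Zero]
  simp only [eval_fH4Zero, eval_pderiv_zero_fH4Zero, eval_pderiv_one_fH4Zero]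
  constructor
  · rintro ⟨p, hf, hx, hy⟩
    obtain ⟨k, h⟩ := exists_isCritPoint hx hy
    have hd := h.det_critF_eq_zero hf
    rw [det_critF _ _ _ _ _ h.sq_root] at hd
    simpa using hd
  · intro hD
    obtain ⟨r, hr⟩ := IsAlgClosed.exists_pow_nat_eq (5 : ℂ) (n := 2) (by norm_num)
    have hk : ((3 + r) / 2) ^ 2 - 3 * ((3 + r) / 2) + 1 = 0 := by linear_combination 1 / 4 * hr
    -- One root `k` suffices here, because the determinant is the same for both.
    obtain ⟨x, y, h, hf⟩ := exists_isCritPoint_of_det_eq_zero hk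
      (by rw [det_critF _ _ _ _ _ hk, hD, mul_zero])
    exact ⟨![x, y], hf, h.pderiv_x, h.pderiv_y⟩

/-! ## The polynomials `D` are square-free -/

theorem leadingCoeff_quartic {R : Type*} [CommRing R] {a : R} (ha : a ≠ 0) (b c d e : R) :
    (Polynomial.C a * Polynomial.X ^ 4 + (Polynomial.C b * Polynomial.X ^ 3 +
      Polynomial.C c * Polynomial.X ^ 2 + Polynomial.C d * Polynomial.X +
      Polynomial.C e)).leadingCoeff = a := by
  rw [Polynomial.leadingCoeff_add_of_degree_lt', Polynomial.leadingCoeff_C_mul_X_pow]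
  rw [Polynomial.degree_C_mul_X_pow 4 ha]
  exact Polynomial.degree_cubic_lt

/-- Only the constant leading coefficient matters for square-freeness; the witnesses are the lower
coefficients in the last variable. -/
theorem exprDH4Zero_C_X {R : Type*} [CommRing R] (r s t : R) :
    ∃ b c d e : R, exprDH4Zero (Polynomial.C r) (Polynomial.C s) (Polynomial.C t) Polynomial.X =
      Polynomial.C 729 * Polynomial.X ^ 4 + (Polynomial.C b * Polynomial.X ^ 3 +
        Polynomial.C c * Polynomial.X ^ 2 + Polynomial.C d * Polynomial.X + Polynomial.C e) := by
  refine ⟨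
    18225 * r ^ 3 * s ^ 2 - 2025 * r ^ 5 * t - 16875 * r ^ 9 * s + 3125 * r ^ 15,
    -23490 * r ^ 2 * s ^ 3 * t + 7290 * r ^ 4 * s * t ^ 2 + 33750 * r ^ 6 * s ^ 4 + 43875 * r ^
    8 * s ^ 2 * t - 375 * r ^ 10 * t ^ 2 - 9375 * r ^ 12 * s ^ 3 - 9375 * r ^ 14 * s * t + 5832
    * s ^ 5 + 216 * t ^ 3,
    12960 * r * s ^ 4 * t ^ 2 - 5940 * r ^ 3 * s ^ 2 * t ^ 3 - 35100 * r ^ 3 * s ^ 7 - 72225 *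
    r ^ 5 * s ^ 5 * t - 12 * r ^ 5 * t ^ 4 - 42450 * r ^ 7 * s ^ 3 * t ^ 2 + 75 * r ^ 9 * s * t
    ^ 3 + 9375 * r ^ 9 * s ^ 6 + 18750 * r ^ 11 * s ^ 4 * t + 9375 * r ^ 13 * s ^ 2 * t ^ 2,
    2280 * r ^ 2 * s ^ 3 * t ^ 4 + 35640 * r ^ 2 * s ^ 8 * t + 120 * r ^ 4 * s * t ^ 5 + 36885
    * r ^ 4 * s ^ 6 * t ^ 2 + 13695 * r ^ 6 * s ^ 4 * t ^ 3 - 3125 * r ^ 6 * s ^ 9 - 105 * r ^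
    8 * s ^ 2 * t ^ 4 - 9375 * r ^ 8 * s ^ 7 * t - 9375 * r ^ 10 * s ^ 5 * t ^ 2 - 27 * r ^ 10
    * t ^ 5 - 3125 * r ^ 12 * s ^ 3 * t ^ 3 - 864 * s ^ 5 * t ^ 3 + 11664 * s ^ 10 + 16 * t ^ 6, ?_⟩
  simp only [exprDH4Zero, map_add, map_sub, map_mul, map_pow, map_neg, map_ofNat]
  ring

theorem exprDH4One_C_X {R : Type*} [CommRing R] (r s t : R) :
    ∃ b c d e : R, exprDH4One (Polynomial.C r) (Polynomial.C s) (Polynomial.C t) Polynomial.X =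
      Polynomial.C 16 * Polynomial.X ^ 4 + (Polynomial.C b * Polynomial.X ^ 3 +
        Polynomial.C c * Polynomial.X ^ 2 + Polynomial.C d * Polynomial.X + Polynomial.C e) := by
  refine ⟨
    480 * r * s ^ 3 + 160 * r ^ 2 * s * t - 920 * r ^ 4 * s ^ 2 - 36 * r ^ 5 * t + 360 * r ^ 7
    * s - 27 * r ^ 10 - 8 * t ^ 2,
    -200 * r * s ^ 3 * t ^ 2 - 40 * r ^ 2 * s * t ^ 3 + 840 * r ^ 2 * s ^ 6 + 3700 * r ^ 3 * s
    ^ 4 * t + 550 * r ^ 4 * s ^ 2 * t ^ 2 - 19976 * r ^ 5 * s ^ 5 + r ^ 5 * t ^ 3 - 3900 * r ^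
    6 * s ^ 3 * t - 30 * r ^ 7 * s * t ^ 2 + 13895 * r ^ 8 * s ^ 4 + 255 * r ^ 9 * s ^ 2 * t -
    1225 * r ^ 11 * s ^ 3 + 288 * s ^ 5 * t + t ^ 4,
    20 * r * s ^ 3 * t ^ 4 + 2880 * r * s ^ 8 * t + 2930 * r ^ 2 * s ^ 6 * t ^ 2 - 805 * r ^ 3
    * s ^ 4 * t ^ 3 - 22520 * r ^ 3 * s ^ 9 - 25600 * r ^ 4 * s ^ 7 * t + 10548 * r ^ 5 * s ^ 5
    * t ^ 2 + 20 * r ^ 6 * s ^ 3 * t ^ 3 + 83175 * r ^ 6 * s ^ 8 - 54350 * r ^ 7 * s ^ 6 * t -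
    605 * r ^ 8 * s ^ 4 * t ^ 2 + 91750 * r ^ 9 * s ^ 7 + 4750 * r ^ 10 * s ^ 5 * t - 10625 * r
    ^ 12 * s ^ 6 - 136 * s ^ 5 * t ^ 3 + 1728 * s ^ 10,
    -720 * r * s ^ 8 * t ^ 3 - 760 * r ^ 2 * s ^ 6 * t ^ 4 + 5400 * r ^ 2 * s ^ 11 * t + 14360
    * r ^ 3 * s ^ 9 * t ^ 2 + 13545 * r ^ 4 * s ^ 7 * t ^ 3 - 16875 * r ^ 4 * s ^ 12 + 16 * r ^
    5 * s ^ 5 * t ^ 4 - 95125 * r ^ 5 * s ^ 10 * t - 115475 * r ^ 6 * s ^ 8 * t ^ 2 - 600 * r ^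
    7 * s ^ 6 * t ^ 3 + 209375 * r ^ 7 * s ^ 11 + 476250 * r ^ 8 * s ^ 9 * t + 7625 * r ^ 9 * s
    ^ 7 * t ^ 2 - 765625 * r ^ 10 * s ^ 10 - 40625 * r ^ 11 * s ^ 8 * t + 78125 * r ^ 13 * s ^
    9 + 16 * s ^ 5 * t ^ 5 - 432 * s ^ 10 * t ^ 2, ?_⟩
  simp only [exprDH4One, map_add, map_sub, map_mul, map_pow, map_neg, map_ofNat]
  ring

theorem toLastVar_polyDH4Zero : toLastVar polyDH4Zero =
    exprDH4Zero (R := Polynomial (MvPolynomial (Fin 3) ℂ)) (Polynomial.C (X 0))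
      (Polynomial.C (X 1)) (Polynomial.C (X 2)) Polynomial.X := by
  simp [polyDH4Zero, exprDH4Zero, toLastVar]
  ring

theorem toLastVar_polyDH4One : toLastVar polyDH4One =
    exprDH4One (R := Polynomial (MvPolynomial (Fin 3) ℂ)) (Polynomial.C (X 0))
      (Polynomial.C (X 1)) (Polynomial.C (X 2)) Polynomial.X := by
  simp [polyDH4One, exprDH4One, toLastVar]
  ring

theorem squarefree_of_bezout {f a b : Polynomial ℂ} {n : ℂ} (hn : n ≠ 0)
    (h : a * f + b * Polynomial.derivative f = Polynomial.C n) : Squarefree f := by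
  refine Polynomial.Separable.squarefree
    ⟨Polynomial.C n⁻¹ * a, Polynomial.C n⁻¹ * b, ?_⟩
  rw [mul_assoc, mul_assoc, ← mul_add, h, ← Polynomial.C_mul, inv_mul_cancel₀ hn,
    Polynomial.C_1]

theorem squarefree_polyDH4Zero : Squarefree polyDH4Zero := by
  -- At `t₁ = 0`, `t₆ = t₁₀ = 1` the quartic is coprime to its derivative; `a` and `b` below are
  -- Bézout cofactors with denominators cleared.
  refine squarefree_of_specialization _ ![0, 1, 1] ?_ ?_
  · obtain ⟨b, c, d, e, h⟩ := exprDH4Zero_C_X (X 0 : MvPolynomial (Fin 3) ℂ) (X 1) (X 2)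
    rw [toLastVar_polyDH4Zero, h, leadingCoeff_quartic (by norm_num)]
    exact (isUnit_iff_ne_zero.mpr (by norm_num : (729 : ℂ) ≠ 0)).map (C (σ := Fin 3))
  · have h : (toLastVar polyDH4Zero).map (eval ![0, 1, 1]) =
        729 * Polynomial.X ^ 4 + 6048 * Polynomial.X ^ 2 + 10816 := by
      simp [toLastVar_polyDH4Zero, exprDH4Zero]
      ring
    refine squarefree_of_bezout (a := 756 * Polynomial.X ^ 2 + 432)
      (b := -189 * Polynomial.X ^ 3 - 892 * Polynomial.X) (n := 4672512) (by norm_num) ?_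
    rw [h]
    simp only [Polynomial.derivative_add, Polynomial.derivative_mul,
      Polynomial.derivative_ofNat, Polynomial.derivative_X_pow, map_ofNat, Nat.cast_ofNat,
      Nat.add_one_sub_one]
    ring

theorem squarefree_X_mul_polyDH4One : Squarefree (X 3 * polyDH4One) := by
  have hX : toLastVar (X 3 * polyDH4One) = Polynomial.X * toLastVar polyDH4One := by
    simp [toLastVar]
  -- Here `t₁ = 0`, `t₃ = t₅ = 1`. The factor `t₁₀` is included, so the specialization is a quintic.
  refine squarefree_of_specialization _ ![0, 1, 1] ?_ ?_
  · obtain ⟨b, c, d, e, h⟩ := exprDH4One_C_X (X 0 : MvPolynomial (Fin 3) ℂ) (X 1) (X 2)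
    rw [hX, toLastVar_polyDH4One, h, Polynomial.leadingCoeff_mul, Polynomial.leadingCoeff_X,
      one_mul, leadingCoeff_quartic (by norm_num)]
    exact (isUnit_iff_ne_zero.mpr (by norm_num : (16 : ℂ) ≠ 0)).map (C (σ := Fin 3))
  · have h : (toLastVar (X 3 * polyDH4One)).map (eval ![0, 1, 1]) =
        16 * Polynomial.X ^ 5 - 8 * Polynomial.X ^ 4 + 289 * Polynomial.X ^ 3 +
          1592 * Polynomial.X ^ 2 - 416 * Polynomial.X := by
      rw [hX]
      simp [toLastVar_polyDH4One, exprDH4One]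
      ring
    refine squarefree_of_bezout
      (a := -9366693563440 * Polynomial.X ^ 3 + 2654345386656 * Polynomial.X ^ 2 -
        101458296327573 * Polynomial.X - 384468183900428)
      (b := 1873338712688 * Polynomial.X ^ 4 - 718202948600 * Polynomial.X ^ 3 +
        33804684823911 * Polynomial.X ^ 2 + 190302703970524 * Polynomial.X - 25368354161696)
      (n := 10553235331265536) (by norm_num) ?_
    rw [h]
    simp only [Polynomial.derivative_add, Polynomial.derivative_sub, Polynomial.derivative_mul,
      Polynomial.derivative_ofNat, Polynomial.derivative_X_pow, Polynomial.derivative_X, map_ofNat,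
      Nat.cast_ofNat, Nat.add_one_sub_one]
    ring

/-! ## The relation between the two families -/

theorem eval_fH4One (t : Fin 4 → ℂ) (p : Fin 2 → ℂ) :
    eval p (fH4One t) = exprFH4One (t 0) (t 1) (t 2) (t 3) (p 0) (p 1) := by
  simp [fH4One, exprFH4One]

theorem eval_polyDH4One (t : Fin 4 → ℂ) :
    eval t polyDH4One = exprDH4One (t 0) (t 1) (t 2) (t 3) := by
  simp [polyDH4One, exprDH4One]

theorem eval_bind₁ {σ τ : Type*} (g : σ → MvPolynomial τ ℂ) (f : MvPolynomial σ ℂ) (p : τ → ℂ) :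
    eval p (bind₁ g f) = eval (fun i => eval p (g i)) f := by
  simpa only [aeval_eq_eval] using aeval_bind₁ p g f

theorem bind₁_fH4One (t : Fin 4 → ℂ) :
    bind₁ ![X 0 - C (2 * t 1), X 1 + C (1 / 3 * (10 * t 0 ^ 2 * t 1 - t 2))] (fH4One t) =
      fH4Zero (substU t) := by
  refine MvPolynomial.funext fun p => ?_
  rw [eval_bind₁, eval_fH4One, eval_fH4Zero]
  simp only [exprFH4One, exprFH4Zero, substU, Matrix.cons_val, map_sub, map_add, eval_X, eval_C]
  ring

theorem eval_substU_polyDH4Zero (t : Fin 4 → ℂ) :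
    eval (substU t) polyDH4Zero = t 3 ^ 2 * eval t polyDH4One := by
  rw [eval_polyDH4Zero, eval_polyDH4One]
  simp only [exprDH4One, exprDH4Zero, substU, Matrix.cons_val]
  ring

theorem pderiv_bind₁_translate {σ : Type*} (c : σ → ℂ) (i : σ) (f : MvPolynomial σ ℂ) :
    pderiv i (bind₁ (fun j => X j + C (c j)) f) = bind₁ (fun j => X j + C (c j)) (pderiv i f) := by
  classical
  induction f using MvPolynomial.induction_on with
  | C a => simp
  | add p q hp hq => simp only [map_add, hp, hq]
  | mul_X p j hp =>
    rw [map_mul, bind₁_X_right, Derivation.leibniz, Derivation.leibniz, hp, map_add, pderiv_C,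
      pderiv_X, Pi.single_apply]
    split_ifs <;> simp

theorem isSingularSurface_translate (c : Fin 2 → ℂ) (f : MvPolynomial (Fin 2) ℂ) :
    IsSingularSurface (surface (bind₁ (fun j => X j + C (c j)) f)) ↔
      IsSingularSurface (surface f) := by
  simp only [isSingularSurface_surface_iff, pderiv_bind₁_translate, eval_bind₁, map_add, eval_X,
    eval_C]
  constructor
  · rintro ⟨p, hp⟩
    exact ⟨_, hp⟩
  · rintro ⟨p, hp⟩
    exact ⟨fun i => p i - c i, by simpa only [sub_add_cancel] using hp⟩

/-- Translations preserve singular points, so `t` lies in the locus iff `D_{H₄(0)}(u) = t₁₀²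
D_{H₄(1)}(t)` vanishes, and the square on `t₁₀` may be dropped. -/
theorem mem_discriminantLocus_fH4One (t : Fin 4 → ℂ) :
    t ∈ discriminantLocus fH4One ↔ eval t (X 3 * polyDH4One) = 0 := by
  have hg : (![X 0 - C (2 * t 1), X 1 + C (1 / 3 * (10 * t 0 ^ 2 * t 1 - t 2))] :
      Fin 2 → MvPolynomial (Fin 2) ℂ) =
      fun j => X j + C ((![-(2 * t 1), 1 / 3 * (10 * t 0 ^ 2 * t 1 - t 2)] : Fin 2 → ℂ) j) := by
    funext j
    fin_cases j
    · simp [sub_eq_add_neg]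
    · rfl
  have h := mem_discriminantLocus_fH4Zero (substU t)
  rw [discriminantLocus, Set.mem_ofPred_eq, ← bind₁_fH4One, hg, isSingularSurface_translate,
    eval_substU_polyDH4Zero] at h
  rw [discriminantLocus, Set.mem_ofPred_eq, h]
  simp

theorem isDiscriminant_fH4Zero : IsDiscriminant fH4Zero polyDH4Zero :=
  ⟨squarefree_polyDH4Zero, Set.ext mem_discriminantLocus_fH4Zero⟩

theorem isDiscriminant_fH4One : IsDiscriminant fH4One (X 3 * polyDH4One) :=
  ⟨squarefree_X_mul_polyDH4One, Set.ext mem_discriminantLocus_fH4One⟩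

/-! ## The coordinate changes are bijective -/

/-- The change is triangular with constant nonzero diagonal, so it is inverted one coordinate at a
time. -/
theorem bijective_coordH4Zero : Function.Bijective coordH4Zero := by
  refine Function.bijective_iff_has_inverse.mpr ⟨fun x =>
    let a := (10 * x 0 ^ 6 - 225 / 4 * x 1) / 27
    let b := (500 * x 0 ^ 10 - 2025 * x 0 ^ 4 * a - 50625 / 2 * x 2) / 486
    ![x 0, a, b, (11390625 / 8 * x 3 - (8125 * x 0 ^ 15 - 47250 * x 0 ^ 9 * a -
      7290 * x 0 ^ 5 * b + 54675 * x 0 ^ 3 * a ^ 2)) / 13122], fun t => ?_, fun x => ?_⟩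
  all_goals
    funext i
    fin_cases i <;> simp [coordH4Zero] <;> ring

theorem bijective_coordH4One : Function.Bijective coordH4One := by
  refine Function.bijective_iff_has_inverse.mpr ⟨fun x =>
    let a := x 2 / 16
    let b := (5 * x 1 - 17 * x 0 ^ 5 + 160 * x 0 ^ 2 * a) / 16
    ![x 0, a, b, (987 * x 0 ^ 10 - 15120 * x 0 ^ 7 * a + 1512 * x 0 ^ 5 * b +
      50400 * x 0 ^ 4 * a ^ 2 - 8960 * x 0 ^ 2 * a * b - 12800 * x 0 * a ^ 3 +
      448 * b ^ 2 - 25 / 8 * x 3) / 2560], fun t => ?_, fun x => ?_⟩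
  all_goals
    funext i
    fin_cases i <;> simp [coordH4One] <;> ring

/-! ## The discriminant of the polynomial potential -/

/-- The potential as a polynomial. -/
noncomputable def potPolyZero : MvPolynomial (Fin 4) ℂ :=
  C (1 / 240) * X 0 * X 1 ^ 5 + C (2 / 3) * X 0 * X 2 ^ 3 + C (1 / 2) * X 0 * X 3 ^ 2 + C (1 /
  18) * X 0 ^ 3 * X 1 ^ 3 * X 2 + C (1 / 15) * X 0 ^ 5 * X 1 * X 2 ^ 2 + C (1 / 1080) * X 0 ^ 7 *
  X 1 ^ 4 + C (1 / 810) * X 0 ^ 9 * X 1 ^ 2 * X 2 + C (8 / 22275) * X 0 ^ 11 * X 2 ^ 2 + C (1 /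
  72900) * X 0 ^ 13 * X 1 ^ 3 + C (2 / 15582375) * X 0 ^ 19 * X 1 ^ 2 + C (32 / 22395255890625) *
  X 0 ^ 31 + X 1 * X 2 * X 3

/-- The gradient of the potential. -/
noncomputable def gradPolyZero : Fin 4 → MvPolynomial (Fin 4) ℂ
  | 0 =>
    C (1 / 6) * X 0 ^ 2 * X 1 ^ 3 * X 2 + C (1 / 3) * X 0 ^ 4 * X 1 * X 2 ^ 2 + C (7 / 1080) *
    X 0 ^ 6 * X 1 ^ 4 + C (1 / 90) * X 0 ^ 8 * X 1 ^ 2 * X 2 + C (8 / 2025) * X 0 ^ 10 * X 2 ^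
    2 + C (13 / 72900) * X 0 ^ 12 * X 1 ^ 3 + C (2 / 820125) * X 0 ^ 18 * X 1 ^ 2 + C (32 /
    722427609375) * X 0 ^ 30 + C (1 / 240) * X 1 ^ 5 + C (2 / 3) * X 2 ^ 3 + C (1 / 2) * X 3 ^
    2
  | 1 =>
    C (1 / 48) * X 0 * X 1 ^ 4 + C (1 / 6) * X 0 ^ 3 * X 1 ^ 2 * X 2 + C (1 / 15) * X 0 ^ 5 * X
    2 ^ 2 + C (1 / 270) * X 0 ^ 7 * X 1 ^ 3 + C (1 / 405) * X 0 ^ 9 * X 1 * X 2 + C (1 / 24300)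
    * X 0 ^ 13 * X 1 ^ 2 + C (4 / 15582375) * X 0 ^ 19 * X 1 + X 2 * X 3
  | 2 =>
    C 2 * X 0 * X 2 ^ 2 + C (1 / 18) * X 0 ^ 3 * X 1 ^ 3 + C (2 / 15) * X 0 ^ 5 * X 1 * X 2 + C
    (1 / 810) * X 0 ^ 9 * X 1 ^ 2 + C (16 / 22275) * X 0 ^ 11 * X 2 + X 1 * X 3
  | 3 =>
    X 0 * X 3 + X 1 * X 2

set_option maxHeartbeats 2000000 in
/-- The Hessian matrix of the potential. -/
noncomputable def hessPolyZero : Fin 4 → Fin 4 → MvPolynomial (Fin 4) ℂ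
  | 0, 0 =>
    C (1 / 3) * X 0 * X 1 ^ 3 * X 2 + C (4 / 3) * X 0 ^ 3 * X 1 * X 2 ^ 2 + C (7 / 180) * X 0 ^
    5 * X 1 ^ 4 + C (4 / 45) * X 0 ^ 7 * X 1 ^ 2 * X 2 + C (16 / 405) * X 0 ^ 9 * X 2 ^ 2 + C
    (13 / 6075) * X 0 ^ 11 * X 1 ^ 3 + C (4 / 91125) * X 0 ^ 17 * X 1 ^ 2 + C (64 /
    48161840625) * X 0 ^ 29
  | 0, 1 | 1, 0 =>
    C (1 / 2) * X 0 ^ 2 * X 1 ^ 2 * X 2 + C (1 / 3) * X 0 ^ 4 * X 2 ^ 2 + C (7 / 270) * X 0 ^ 6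
    * X 1 ^ 3 + C (1 / 45) * X 0 ^ 8 * X 1 * X 2 + C (13 / 24300) * X 0 ^ 12 * X 1 ^ 2 + C (4 /
    820125) * X 0 ^ 18 * X 1 + C (1 / 48) * X 1 ^ 4
  | 0, 2 | 2, 0 =>
    C (1 / 6) * X 0 ^ 2 * X 1 ^ 3 + C (2 / 3) * X 0 ^ 4 * X 1 * X 2 + C (1 / 90) * X 0 ^ 8 * X
    1 ^ 2 + C (16 / 2025) * X 0 ^ 10 * X 2 + C 2 * X 2 ^ 2
  | 0, 3 | 3, 0 =>
    X 3
  | 1, 1 =>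
    C (1 / 12) * X 0 * X 1 ^ 3 + C (1 / 3) * X 0 ^ 3 * X 1 * X 2 + C (1 / 90) * X 0 ^ 7 * X 1 ^
    2 + C (1 / 405) * X 0 ^ 9 * X 2 + C (1 / 12150) * X 0 ^ 13 * X 1 + C (4 / 15582375) * X 0 ^
    19
  | 1, 2 | 2, 1 =>
    C (1 / 6) * X 0 ^ 3 * X 1 ^ 2 + C (2 / 15) * X 0 ^ 5 * X 2 + C (1 / 405) * X 0 ^ 9 * X 1 +
    X 3
  | 1, 3 | 3, 1 =>
    X 2
  | 2, 2 =>
    C 4 * X 0 * X 2 + C (2 / 15) * X 0 ^ 5 * X 1 + C (16 / 22275) * X 0 ^ 11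
  | 2, 3 | 3, 2 =>
    X 1
  | 3, 3 =>
    X 0

theorem potH4Zero_eq : potH4Zero = fun x => eval x potPolyZero := by
  funext x
  simp only [potH4Zero, potPolyZero, map_add, map_mul, map_pow, eval_X, eval_C]
  ring

theorem pderiv_potPolyZero (k : Fin 4) : pderiv k potPolyZero = gradPolyZero k := by
  refine MvPolynomial.funext fun x => ?_
  fin_cases k <;> simp [potPolyZero, gradPolyZero, pderiv_X, Derivation.leibniz] <;> ring

set_option maxHeartbeats 8000000 in
theorem pderiv_gradPolyZero (i k : Fin 4) : pderiv i (gradPolyZero k) = hessPolyZero i k := by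
  refine MvPolynomial.funext fun x => ?_
  fin_cases i <;> fin_cases k <;>
    simp [gradPolyZero, hessPolyZero, pderiv_X, Derivation.leibniz] <;> ring

theorem hessC_potH4Zero (i j : Fin 4) :
    hessC potH4Zero i j = fun x => eval x (hessPolyZero i (Fin.rev j)) := by
  rw [hessC, potH4Zero_eq, pd_eval, pd_eval, pderiv_potPolyZero, pderiv_gradPolyZero]

-- Euler's identity: the potential has degree `31/15 = 2 + w₁`, and two derivatives lower it by `wᵢ
-- + wₖ`.
set_option maxHeartbeats 8000000 in
theorem euler_hessPolyZero (i k : Fin 4) (x : Fin 4 → ℂ) :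
    euler wH4Zero (fun x => eval x (hessPolyZero i k)) x =
      (31 / 15 - wH4Zero i - wH4Zero k) * eval x (hessPolyZero i k) := by
  simp only [euler, pd_eval, Fin.sum_univ_four]
  fin_cases i <;> fin_cases k <;>
    simp [wH4Zero, hessPolyZero, pderiv_X, Derivation.leibniz, -mul_eq_mul_left_iff,
      -mul_eq_mul_right_iff] <;> ring

-- The constant can be read off from `t₁₅⁴`: the coefficient of `x₄⁴` in `det T` is `1` and that of
-- `t₁₅` in `x₄` is `144/15625`, giving `(144/15625)⁴ / 729`.
set_option maxHeartbeats 8000000 in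
theorem discr_potH4Zero (t : Fin 4 → ℂ) :
    discr wH4Zero potH4Zero (coordH4Zero t) =
      589824 / 59604644775390625 * eval t polyDH4Zero := by
  rw [discr, det_fin_four, eval_polyDH4Zero]
  simp only [matT, Matrix.of_apply, hessC_potH4Zero, euler_hessPolyZero, Fin.reduceRev]
  simp only [hessPolyZero, coordH4Zero, wH4Zero, exprDH4Zero, Matrix.cons_val,
    map_add, map_mul, map_pow, eval_X, eval_C]
  ring

/-! ## The discriminant of the algebraic potential -/

/-- The potential as a polynomial. -/
noncomputable def potPolyOne : MvPolynomial (Fin 4) ℂ :=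
  C 12 * X 0 * X 1 ^ 2 * X 3 - C 4 * X 0 * X 1 ^ 4 + C (1 / 2) * X 0 * X 3 ^ 2 + C (1 / 6) * X 0
  ^ 3 * X 2 ^ 6 + C 5 * X 0 ^ 4 * X 1 * X 2 ^ 4 + C 80 * X 0 ^ 5 * X 1 ^ 2 * X 2 ^ 2 - C 4 * X 0
  ^ 6 * X 1 * X 3 + C 544 * X 0 ^ 6 * X 1 ^ 3 - C (17 / 18) * X 0 ^ 9 * X 2 ^ 4 - C (20 / 3) * X
  0 ^ 10 * X 1 * X 2 ^ 2 - C (320 / 11) * X 0 ^ 11 * X 1 ^ 2 - C (68 / 45) * X 0 ^ 15 * X 2 ^ 2 -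
  C (160 / 3) * X 0 ^ 16 * X 1 + C (18596 / 1197) * X 0 ^ 21 + X 1 * X 3 * X 2 ^ 2 - C (8 / 3) *
  X 1 ^ 3 * X 2 ^ 2 + C (1 / 105) * X 2 ^ 7

/-- The gradient of the potential. -/
noncomputable def gradPolyOne : Fin 4 → MvPolynomial (Fin 4) ℂ
  | 0 =>
    C (1 / 2) * X 0 ^ 2 * X 2 ^ 6 + C 14 * X 0 ^ 3 * X 1 * X 2 ^ 4 + C 280 * X 0 ^ 4 * X 1 ^ 2
    * X 2 ^ 2 + C 2240 * X 0 ^ 5 * X 1 ^ 3 + C (4 / 5) * X 0 ^ 5 * X 2 ^ 5 + C (7 / 2) * X 0 ^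
    8 * X 2 ^ 4 + C 196 * X 0 ^ 9 * X 1 * X 2 ^ 2 + C 1680 * X 0 ^ 10 * X 1 ^ 2 - C 68 * X 0 ^
    14 * X 2 ^ 2 - C (4976 / 5) * X 0 ^ 15 * X 1 + C (27548 / 95) * X 0 ^ 20 - C (2 / 5) * X 1
    * X 2 ^ 5 + C 28 * X 1 ^ 4 + C (1 / 2) * X 3 ^ 2
  | 1 =>
    C 12 * X 0 * X 1 * X 3 + C 16 * X 0 * X 1 ^ 3 - C (2 / 5) * X 0 * X 2 ^ 5 - X 0 ^ 4 * X 2 ^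
    4 + C 40 * X 0 ^ 5 * X 1 * X 2 ^ 2 + C 672 * X 0 ^ 6 * X 1 ^ 2 - C 4 * X 0 ^ 6 * X 3 + C 16
    * X 0 ^ 10 * X 2 ^ 2 + C (240 / 11) * X 0 ^ 11 * X 1 - C (176 / 5) * X 0 ^ 16 - C 8 * X 1 ^
    2 * X 2 ^ 2 + X 3 * X 2 ^ 2
  | 2 =>
    C (1 / 2) * X 0 ^ 3 * X 2 ^ 4 + C 10 * X 0 ^ 4 * X 1 * X 2 ^ 2 + C 80 * X 0 ^ 5 * X 1 ^ 2 -
    C (17 / 9) * X 0 ^ 9 * X 2 ^ 2 - C (20 / 3) * X 0 ^ 10 * X 1 - C (68 / 45) * X 0 ^ 15 + X 1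
    * X 3 - C (8 / 3) * X 1 ^ 3 + C (1 / 30) * X 2 ^ 5
  | 3 =>
    C 12 * X 0 * X 1 ^ 2 + X 0 * X 3 - C 4 * X 0 ^ 6 * X 1 + X 1 * X 2 ^ 2

set_option maxHeartbeats 2000000 in
/-- The Hessian matrix of the potential. -/
noncomputable def hessPolyOne : Fin 4 → Fin 4 → MvPolynomial (Fin 4) ℂ
  | 0, 0 =>
    X 0 * X 2 ^ 6 + C 24 * X 0 ^ 2 * X 1 * X 2 ^ 4 + C 784 * X 0 ^ 3 * X 1 ^ 2 * X 2 ^ 2 + C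
    7840 * X 0 ^ 4 * X 1 ^ 3 + C 4 * X 0 ^ 4 * X 2 ^ 5 - C 48 * X 0 ^ 5 * X 1 * X 2 ^ 3 + C 64
    * X 0 ^ 7 * X 2 ^ 4 + C 2352 * X 0 ^ 8 * X 1 * X 2 ^ 2 + C 21168 * X 0 ^ 9 * X 1 ^ 2 + C 48
    * X 0 ^ 10 * X 2 ^ 3 - C 784 * X 0 ^ 13 * X 2 ^ 2 - C 9408 * X 0 ^ 14 * X 1 + C (79184 /
    19) * X 0 ^ 19 + C 12 * X 1 ^ 2 * X 2 ^ 3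
  | 0, 1 | 1, 0 =>
    C 12 * X 0 * X 1 * X 2 ^ 3 - C 4 * X 0 ^ 3 * X 2 ^ 4 + C 224 * X 0 ^ 4 * X 1 * X 2 ^ 2 + C
    3360 * X 0 ^ 5 * X 1 ^ 2 - C 24 * X 0 ^ 6 * X 2 ^ 3 + C 112 * X 0 ^ 9 * X 2 ^ 2 + C 1008 *
    X 0 ^ 10 * X 1 - C (896 / 5) * X 0 ^ 15 + C 112 * X 1 ^ 3 - C (2 / 5) * X 2 ^ 5
  | 0, 2 | 2, 0 =>
    C (3 / 2) * X 0 ^ 2 * X 2 ^ 4 + C 28 * X 0 ^ 3 * X 1 * X 2 ^ 2 + C 280 * X 0 ^ 4 * X 1 ^ 2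
    + C 2 * X 0 ^ 5 * X 2 ^ 3 + C 7 * X 0 ^ 8 * X 2 ^ 2 + C 196 * X 0 ^ 9 * X 1 - C 68 * X 0 ^
    14 - X 1 * X 2 ^ 3
  | 0, 3 | 3, 0 =>
    X 3
  | 1, 1 =>
    C 144 * X 0 * X 1 ^ 2 + C 12 * X 0 ^ 2 * X 2 ^ 3 + C 64 * X 0 ^ 5 * X 2 ^ 2 + C 864 * X 0 ^
    6 * X 1 - C (1872 / 11) * X 0 ^ 11 - C 16 * X 1 * X 2 ^ 2
  | 1, 2 | 2, 1 =>
    -X 0 * X 2 ^ 3 - C 2 * X 0 ^ 4 * X 2 ^ 2 + C 40 * X 0 ^ 5 * X 1 + C 16 * X 0 ^ 10 - C 8 * X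
    1 ^ 2 + X 3
  | 1, 3 | 3, 1 =>
    C 12 * X 0 * X 1 - C 4 * X 0 ^ 6 + X 2 ^ 2
  | 2, 2 =>
    X 0 ^ 3 * X 2 ^ 2 + C 10 * X 0 ^ 4 * X 1 - C (17 / 9) * X 0 ^ 9 + C (1 / 12) * X 2 ^ 3
  | 2, 3 | 3, 2 =>
    X 1
  | 3, 3 =>
    X 0

/-- The hypothesis is the chain rule multiplied by `2 z`, hence a polynomial identity; `z ≠ 0` on a
branch permits cancelling. -/
theorem IsBranch.pd_eval_of_eq {U : Set (Fin 4 → ℂ)} {z : (Fin 4 → ℂ) → ℂ} (h : IsBranch U z)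
    (j : Fin 4) (p q : MvPolynomial (Fin 4) ℂ)
    (hpq : ∀ s : Fin 4 → ℂ, (if j = 2 then 0 else eval s (pderiv j p)) * (2 * s 2) +
      eval s (pderiv 2 p) * coverGrad s j = 2 * s 2 * eval s q) :
    Set.EqOn (pd j (fun y => eval (branchPoint z y) p)) (fun y => eval (branchPoint z y) q) U := by
  intro x hx
  have hz := h.ne_zero hx
  have hs : (if j = 2 then 0 else eval (branchPoint z x) (pderiv j p)) * (2 * z x) +
      eval (branchPoint z x) (pderiv 2 p) * coverGrad x j =
      2 * z x * eval (branchPoint z x) q := hpq (branchPoint z x)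
  refine mul_left_cancel₀ (mul_ne_zero two_ne_zero hz) ?_
  rw [h.pd_eval hx, ← hs]
  field_simp

theorem IsBranch.potH4One_eqOn {U : Set (Fin 4 → ℂ)} {z : (Fin 4 → ℂ) → ℂ} (h : IsBranch U z) :
    Set.EqOn (potH4One z) (fun y => eval (branchPoint z y) potPolyOne) U := by
  intro x hx
  simp only [potH4One, potPolyOne, branchPoint, map_add, map_sub, map_mul, map_pow,
    eval_X, eval_C, Matrix.cons_val]
  -- Only the term `x₂ x₃ x₄` contains `x₃`, which is replaced by `z² - 4 x₁ (x₁⁵ - 3 x₂)`.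
  linear_combination (-x 1 * x 3) * h.2.2 x hx

set_option maxHeartbeats 8000000 in
theorem gradPolyOne_spec (j : Fin 4) (s : Fin 4 → ℂ) :
    (if j = 2 then 0 else eval s (pderiv j potPolyOne)) * (2 * s 2) +
      eval s (pderiv 2 potPolyOne) * coverGrad s j = 2 * s 2 * eval s (gradPolyOne j) := by
  fin_cases j <;>
    simp [potPolyOne, gradPolyOne, coverGrad, pderiv_X, Derivation.leibniz] <;> ring

-- The factor `2 z` on the right shows that the second derivatives again have no denominator.
set_option maxHeartbeats 8000000 in
theorem hessPolyOne_spec (i k : Fin 4) (s : Fin 4 → ℂ) :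
    (if i = 2 then 0 else eval s (pderiv i (gradPolyOne k))) * (2 * s 2) +
      eval s (pderiv 2 (gradPolyOne k)) * coverGrad s i = 2 * s 2 * eval s (hessPolyOne i k) := by
  fin_cases i <;> fin_cases k <;>
    simp [gradPolyOne, hessPolyOne, coverGrad, pderiv_X, Derivation.leibniz] <;> ring

-- Euler's identity on the cover, where the potential has degree `21/10` and `z` has weight `3/10`;
-- index `2` in `wH4One` still refers to `∂/∂x₃`, of weight `3/5`.
set_option maxHeartbeats 8000000 in
theorem weighted_hessPolyOne (i k : Fin 4) (s : Fin 4 → ℂ) :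
    1 / 10 * s 0 * eval s (pderiv 0 (hessPolyOne i k)) +
      1 / 2 * s 1 * eval s (pderiv 1 (hessPolyOne i k)) +
      3 / 10 * s 2 * eval s (pderiv 2 (hessPolyOne i k)) +
      s 3 * eval s (pderiv 3 (hessPolyOne i k)) =
      (21 / 10 - wH4One i - wH4One k) * eval s (hessPolyOne i k) := by
  fin_cases i <;> fin_cases k <;>
    simp [wH4One, hessPolyOne, pderiv_X, Derivation.leibniz, -mul_eq_mul_left_iff,
      -mul_eq_mul_right_iff] <;> ring

/-- The matrix `T` of the algebraic potential in the coordinates `(x₁, x₂, z, x₄)`. -/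
noncomputable def matTPolyOne : Matrix (Fin 4) (Fin 4) (MvPolynomial (Fin 4) ℂ) :=
  Matrix.of fun i j =>
    C (21 / 10 - wH4One i - wH4One (Fin.rev j)) * hessPolyOne i (Fin.rev j)

theorem IsBranch.matT_potH4One {U : Set (Fin 4 → ℂ)} {z : (Fin 4 → ℂ) → ℂ} (h : IsBranch U z)
    {x : Fin 4 → ℂ} (hx : x ∈ U) (i j : Fin 4) :
    matT wH4One (potH4One z) x i j = eval (branchPoint z x) (matTPolyOne i j) := by
  have hH : Set.EqOn (hessC (potH4One z) i j)
      (fun y => eval (branchPoint z y) (hessPolyOne i (Fin.rev j))) U :=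
    (pd_congr h.1 ((pd_congr h.1 h.potH4One_eqOn _).trans
      (h.pd_eval_of_eq _ _ _ (gradPolyOne_spec _))) i).trans
      (h.pd_eval_of_eq _ _ _ (hessPolyOne_spec i _))
  have hE : euler wH4One (hessC (potH4One z) i j) x =
      euler wH4One (fun y => eval (branchPoint z y) (hessPolyOne i (Fin.rev j))) x := by
    simp only [euler, pd_congr h.1 hH _ hx]
  rw [matT, Matrix.of_apply, hE, h.euler_eval hx, matTPolyOne, Matrix.of_apply, map_mul, eval_C]
  exact weighted_hessPolyOne i (Fin.rev j) (branchPoint z x)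

theorem IsBranch.discr_potH4One {U : Set (Fin 4 → ℂ)} {z : (Fin 4 → ℂ) → ℂ} (h : IsBranch U z)
    {x : Fin 4 → ℂ} (hx : x ∈ U) :
    discr wH4One (potH4One z) x = eval (branchPoint z x) matTPolyOne.det := by
  rw [RingHom.map_det, discr]
  congr 1
  ext i j
  exact h.matT_potH4One hx i j

-- The constant can be read off from `t₁₀⁴`: `x₄⁴` has coefficient `1` in the determinant, `t₁₀` has
-- coefficient `-4096/5` in `x₄`, and `t₁₀⁴` has coefficient `16` in `D`.
set_option maxHeartbeats 8000000 in
theorem eval_coordH4One_det_matTPolyOne (t : Fin 4 → ℂ) :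
    eval (coordH4One t) matTPolyOne.det = 17592186044416 / 625 * eval t polyDH4One := by
  rw [RingHom.map_det, det_fin_four, eval_polyDH4One]
  simp only [RingHom.mapMatrix_apply, Matrix.map_apply, matTPolyOne, Matrix.of_apply,
    Fin.reduceRev, map_mul, eval_C]
  simp only [hessPolyOne, coordH4One, wH4One, exprDH4One, Matrix.cons_val,
    map_add, map_sub, map_neg, map_mul, map_pow, eval_X, eval_C]
  ring

end H4Family

theorem mainTheorem5 :
    -- the family `H₄(0)` and the polynomial potential
    (IsDiscriminant fH4Zero polyDH4Zero ∧
      Function.Bijective coordH4Zero ∧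
      ∃ c : ℂ, c ≠ 0 ∧ ∀ t : Fin 4 → ℂ,
        discr wH4Zero potH4Zero (coordH4Zero t) = c * eval t polyDH4Zero) ∧
    -- the family `H₄(1)` and the algebraic potential, whose `det T` is a polynomial `Δ` in
    -- `(x₁, x₂, z, x₄)`; branches of `z` exist at all points with `z ≠ 0`
    (IsDiscriminant fH4One (X 3 * polyDH4One) ∧
      Function.Bijective coordH4One ∧
      (∀ s : Fin 4 → ℂ, s 2 ≠ 0 →
        ∃ (U : Set (Fin 4 → ℂ)) (z : (Fin 4 → ℂ) → ℂ),
          IsBranch U z ∧ basePoint s ∈ U ∧ z (basePoint s) = s 2) ∧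
      ∃ Δ : MvPolynomial (Fin 4) ℂ,
        (∀ (U : Set (Fin 4 → ℂ)) (z : (Fin 4 → ℂ) → ℂ), IsBranch U z →
          ∀ x ∈ U, discr wH4One (potH4One z) x = eval ![x 0, x 1, z x, x 3] Δ) ∧
        ∃ c : ℂ, c ≠ 0 ∧ ∀ t : Fin 4 → ℂ, eval (coordH4One t) Δ = c * eval t polyDH4One) ∧
    -- the two families and their discriminants are related by the substitution `t ↦ u`
    (∀ t : Fin 4 → ℂ,
      bind₁ ![X 0 - C (2 * t 1), X 1 + C (1 / 3 * (10 * t 0 ^ 2 * t 1 - t 2))] (fH4One t) =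
          fH4Zero (substU t) ∧
        eval (substU t) polyDH4Zero = t 3 ^ 2 * eval t polyDH4One) := by
  refine ⟨⟨isDiscriminant_fH4Zero, bijective_coordH4Zero, _, ?_, discr_potH4Zero⟩,
    ⟨isDiscriminant_fH4One, bijective_coordH4One, exists_isBranch, matTPolyOne.det,
      fun _ _ h _ hx => h.discr_potH4One hx, _, ?_, eval_coordH4One_det_matTPolyOne⟩,
    fun t => ⟨bind₁_fH4One t, eval_substU_polyDH4Zero t⟩⟩
  · norm_num
  · norm_num
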